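/- For $N=2^n$ ($n\ge 0$) let $\star_n$ be the Laver table operation on $\{1,\dots,N\}$, i.e. the unique binary operation with $p\star_n 1\equiv p+1 \pmod N$ and $p\star_n(q\star_n 1)=(p\star_n q)\star_n(p\star_n 1)$ for all $p,q$. For nonnegative integers $p,q$ put $p*q:=2^n-(2^n-p)\star_n(2^n-q)$, where $n$ is such that $p,q<2^n$ (the value does not depend on the choice of $n$). For $p\ge 1$ the sequence $p*0,\,p*1,\,p*2,\dots$ is periodic; let $\pi(p)$ be its least positive period. Let $\mathrm{bit}(m)$ be the number of ones in the binary expansion of $m$, and call an integer $p\ge1$ *maximal* if $\pi(p)=2^{\mathrm{bit}(p-1)}$. A *binary partition* of an integer is a partition all of whose parts are powers of $2$ (including $1=2^0$). **Theorem.** Let $n\ge 2$. 1. Let $$n-1=(b_1+1)2^{a_1}+(b_2+1)2^{a_2}+\dots+(b_r+1)2^{a_r},\qquad 0\le a_1<a_2<\dots<a_r,\quad b_i\ge 0,$$ be a binary partition of $n-1$ (so $b_i+1$ is the multiplicity of the part $2^{a_i}$). Then the binary word (most significant digit first, exponents denoting repetition) $$1\,1^{2^{a_1}}0^{b_12^{a_1}}1^{2^{a_2}}0^{b_22^{a_2}}\cdots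 1^{2^{a_r}}0^{b_r2^{a_r}}$$ is the binary expansion of $p-1$ for some maximal $p$ with $2^{n-1}+2^{n-2}<p\le 2^n$, and $\pi(p)=2^{m}$ with $m=1+2^{a_1}+\dots+2^{a_r}$. 2. Conversely, for every maximal $p$ with $2^{n-1}+2^{n-2}<p\le 2^n$, the binary expansion of $p-1$ is of this form for some binary partition of $n-1$. 3. The correspondence of 1 is a bijection between the binary partitions of $n-1$ and the maximal elements $p$ with $2^{n-1}+2^{n-2}<p\le 2^n$. -/

import Mathlib

/-- The operation `⋆` on `{1, …, N}` determined by `p ⋆ 1 = p + 1 mod N` and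
`p ⋆ (q + 1) = (p ⋆ q) ⋆ (p + 1)` (for `p < N`), by recursion descending on `p` and ascending on
`q`; the row of `N` is the identity.  The value `p ⋆ 0 = N` is the convention "`0` is `N` mod `N`",
for which the recursion gives `p ⋆ 1 = N ⋆ (p + 1) = p + 1`.  The test `p < r` is only there to
make the recursion visibly terminate: it always succeeds (`laverStar_bounds`).  Only arguments
`1 ≤ p, q ≤ N` are meaningful. -/
def laverStar (N p q : ℕ) : ℕ :=
  if p < N then
    match q with
    | 0 => N
    | k + 1 =>
      let r := laverStar N p k
      if p < r then laverStar N r (p + 1) else 0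
  else q
termination_by (N - p, q)
decreasing_by
  · exact Prod.Lex.right _ (Nat.lt_succ_self _)
  · exact Prod.Lex.left _ _ (by omega)

theorem laverStar_top (N q : ℕ) : laverStar N N q = q := by
  rw [laverStar.eq_def]; simp

theorem laverStar_zero {N p : ℕ} (hp : p < N) : laverStar N p 0 = N := by
  rw [laverStar]; simp [hp]

theorem laverStar_bounds (N p : ℕ) (hp : p < N) (q : ℕ) :
    p < laverStar N p q ∧ laverStar N p q ≤ N := by
  induction hd : N - p using Nat.strong_induction_on generalizing p q with
  | _ d ih =>
    induction q with
    | zero => rw [laverStar_zero hp]; exact ⟨hp, le_rfl⟩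
    | succ k ihk =>
      rw [laverStar]
      simp only [hp, ihk.1, if_true]
      rcases Nat.lt_or_ge (laverStar N p k) N with h | h
      · have := ih (N - laverStar N p k) (by omega) (laverStar N p k) h (p + 1) rfl
        omega
      · have h' : laverStar N p k = N := le_antisymm ihk.2 h
        rw [h', laverStar_top]
        omega

theorem laverStar_succ {N p : ℕ} (hp : p < N) (q : ℕ) :
    laverStar N p (q + 1) = laverStar N (laverStar N p q) (p + 1) := by
  conv_lhs => rw [laverStar]
  simp [hp, (laverStar_bounds N p hp q).1]

theorem laverStar_one {N p : ℕ} (hp : p < N) : laverStar N p 1 = p + 1 := by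
  rw [laverStar_succ hp, laverStar_zero hp, laverStar_top]

/-- The defining relation `p ⋆ (q ⋆ 1) = (p ⋆ q) ⋆ (p ⋆ 1)`. -/
theorem laverStar_rel {N p q : ℕ} (hp : p ≤ N) (hq : q < N) :
    laverStar N p (laverStar N q 1) = laverStar N (laverStar N p q) (laverStar N p 1) := by
  rcases Nat.lt_or_ge p N with h | h
  · rw [laverStar_one hq, laverStar_one h, laverStar_succ h]
  · obtain rfl : p = N := le_antisymm hp h
    simp only [laverStar_top]

/-- The backwards operation on nonnegative integers, `p * q = N - (N - p) ⋆ (N - q)`, where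
`N = 2 ^ n` and `n` is the least integer with `p, q < 2 ^ n`. -/
def laverBack (p q : ℕ) : ℕ :=
  2 ^ Nat.size (max p q) -
    laverStar (2 ^ Nat.size (max p q)) (2 ^ Nat.size (max p q) - p) (2 ^ Nat.size (max p q) - q)

/-- The period `π(p)`: the least positive period of the sequence `p * 0, p * 1, p * 2, …`. -/
noncomputable def laverPeriod (p : ℕ) : ℕ :=
  sInf {t : ℕ | 0 < t ∧ Function.Periodic (laverBack p) t}

/-- The number of ones in the binary expansion of `n`. -/
def bitCount (n : ℕ) : ℕ := (Nat.digits 2 n).count 1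

/-- A positive integer `p` is maximal if `π(p) = 2 ^ bit(p - 1)`. -/
def IsLaverMaximal (p : ℕ) : Prop := 0 < p ∧ laverPeriod p = 2 ^ bitCount (p - 1)

/-- Binary partitions of `n`: partitions all of whose parts are powers of `2`. -/
def BinaryPartition (n : ℕ) : Type :=
  {P : Nat.Partition n // ∀ i ∈ P.parts, ∃ a : ℕ, i = 2 ^ a}

/-- The binary word
`1 1^{2^{a_1}} 0^{b_1 2^{a_1}} 1^{2^{a_2}} 0^{b_2 2^{a_2}} ⋯ 1^{2^{a_r}} 0^{b_r 2^{a_r}}`,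
most significant digit first. -/
def maximalWord {r : ℕ} (a b : Fin r → ℕ) : List ℕ :=
  1 :: (List.ofFn fun i =>
    List.replicate (2 ^ a i) 1 ++ List.replicate (b i * 2 ^ a i) 0).flatten

/-!
The whole argument takes place in the Laver tables themselves, read on residues: `lv n x y` is the
operation of the table of size `2 ^ n`, with `0` standing for `2 ^ n`.  Reduction modulo `2 ^ m` is
a homomorphism (`lv_mod`), the upper half of a table is a copy of the previous table (`lv_top`),
the operation is left distributive (`lv_lv`), and the row of `x` has period `2 ^ lvOrd n x`.  The
element `p` corresponds to `x = 2 ^ n - p`, whose digits are the complements of those of `p - 1`.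
Since the period at most doubles from one level to the next, and stays the same when the new digit
of `p - 1` is `0`, it is at most `2 ^ bit (p - 1)`; `p` is maximal when it doubles at every `1`.
The digits of `p - 1`, most significant first, form a *mask*, a list of Booleans.

The arithmetic input consists of two facts about periods.

* `lvScale_of_dvd`: if `2 ^ s ∣ h`, then in the table of size `2 ^ (h + 2 * 2 ^ s)` the multiples of
  `2 ^ h` form a copy of a smaller table.  Consequently `1^m 0^h` is a maximal mask for
  `m ≤ 2 * 2 ^ s`, and `lvOrd_pred_two_pow_le` says that this bound is sharp.
* `lvOrd_le_of_class`: a bound for the periods in a residue class.  It makes the row of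
  `2 ^ a * (2 ^ g - 1)` computable (`lv_spread`), and shows that `1 1^m 0^g 1^a` is a maximal mask
  when `m < 2 * 2 ^ s`, `2 ^ s ∣ g` and `2 ^ (s + 1) ∣ a` (`maskMax_ones_zeros_ones`).

Both rest on one trick, `lvOrd_le_of_lv`: by left distributivity, a bound for the period of `x ⋆ q`
with a well-chosen `q` gives the same bound for `x`.  As `x ⋆ q > x`, this can be used in a
descending induction on `x`.

The combinatorial part uses that the row of a maximal mask `w` deposits the digits of its argument
at the ones of `w` (`MaskMax.lv_eq`).  So the period of a submask of `w` is that of the submask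
compressed to the ones of `w` (`MaskMax.maskOrd_fill`), and maximality of one mask can be moved to
others.  If a mask is made of blocks `1^{2^a} 0^{b 2^a}` with `a` increasing from the top, filling
up its last block and everything below gives a maximal mask by induction, and compression
turns the original mask into some `1 1^m 0^g 1^a`; hence it is maximal (`maskMax_blockWord`).
Conversely, adding a digit `1` on top of such a word creates a block of size `1`; when it meets a
block of its own size, maximality forces the two to be adjacent and aligned, so that they merge to a
block of twice the size, and so on as in a carry (`exists_blockWord_of_maskMax`).  The obstructions
are `not_maskMax_of_odd`, which compresses a mask in two ways, and `not_maskMax_of_gap`, which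
compares two consecutive values of a row.

Finally, the sizes of the blocks are the binary digits of the number of ones of the word, so that
the word determines its blocks, which amount to a binary partition.
-/

/-! ### The Laver table on residues -/

/-- The representative in `{1, …, 2 ^ n}` of `x` modulo `2 ^ n`. -/
def lvRep (n x : ℕ) : ℕ := if x % 2 ^ n = 0 then 2 ^ n else x % 2 ^ n

/-- The Laver operation of `{1, …, 2 ^ n}`, read on residues modulo `2 ^ n`: the left argument is
any natural number, taken modulo `2 ^ n`, and the value is the residue in `[0, 2 ^ n)`.  In
particular `0` stands for `2 ^ n`. -/
def lv (n x y : ℕ) : ℕ := laverStar (2 ^ n) (lvRep n x) y % 2 ^ n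

theorem lvRep_le (n x : ℕ) : lvRep n x ≤ 2 ^ n := by
  unfold lvRep; split_ifs
  · exact le_rfl
  · exact (Nat.mod_lt _ (by positivity)).le

theorem lvRep_modEq (n x : ℕ) : lvRep n x ≡ x [MOD 2 ^ n] := by
  unfold lvRep; split_ifs with h
  · simp [Nat.ModEq, h]
  · simp [Nat.ModEq]

theorem lvRep_congr {n x x' : ℕ} (h : x ≡ x' [MOD 2 ^ n]) : lvRep n x = lvRep n x' := by
  unfold lvRep; rw [h]

theorem lvRep_of_pos_of_le {n x : ℕ} (h0 : 0 < x) (h : x ≤ 2 ^ n) : lvRep n x = x := by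
  unfold lvRep
  rcases h.lt_or_eq with h | h
  · rw [Nat.mod_eq_of_lt h]; split_ifs <;> omega
  · simp [h]

theorem lv_lt (n x y : ℕ) : lv n x y < 2 ^ n := Nat.mod_lt _ (by positivity)

theorem lv_congr_left {n x x' : ℕ} (h : x ≡ x' [MOD 2 ^ n]) (y : ℕ) : lv n x y = lv n x' y := by
  unfold lv; rw [lvRep_congr h]

theorem lv_zero_left (n y : ℕ) : lv n 0 y = y % 2 ^ n := by
  simp [lv, lvRep, laverStar_top]

theorem lv_zero_right (n x : ℕ) : lv n x 0 = 0 := by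
  unfold lv
  rcases (lvRep_le n x).lt_or_eq with h | h
  · rw [laverStar_zero h]; simp
  · rw [h, laverStar_top]; simp

/-- The recursion before the periodicity in the right argument is known. -/
theorem lv_succ_rep (n x y : ℕ) : lv n x (y + 1) = lv n (lv n x y) (lvRep n x % 2 ^ n + 1) := by
  rcases (lvRep_le n x).lt_or_eq with h | h
  · rw [Nat.mod_eq_of_lt h]
    unfold lv
    rw [laverStar_succ h]
    have hb := laverStar_bounds _ _ h y
    rw [lvRep_congr (Nat.mod_modEq _ _), lvRep_of_pos_of_le (by omega) hb.2]
  · have hx : x ≡ 0 [MOD 2 ^ n] := by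
      have := lvRep_modEq n x
      rw [h] at this
      exact this.symm.trans (by simp [Nat.ModEq])
    have hy := lv_congr_left hx
    rw [hy, hy, h, lv_zero_left, lv_zero_left, Nat.mod_self, zero_add]
    unfold lv
    rcases (lvRep_le n (y % 2 ^ n)).lt_or_eq with h' | h'
    · rw [laverStar_one h']
      exact ((lvRep_modEq n _).trans (Nat.mod_modEq _ _)).symm.add_right 1
    · rw [h', laverStar_top]
      have : y ≡ 0 [MOD 2 ^ n] := by
        have h2 := (lvRep_modEq n (y % 2 ^ n)).trans (Nat.mod_modEq _ _)
        rw [h'] at h2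
        exact h2.symm.trans (by simp [Nat.ModEq])
      exact this.add_right 1

/-- Descending induction on residues, `0` being the largest one. -/
theorem residue_induction {N : ℕ} {P : ℕ → Prop} (h0 : P 0)
    (h : ∀ x, 0 < x → x < N → (∀ y < N, (y = 0 ∨ x < y) → P y) → P x) : ∀ x < N, P x := by
  intro x
  induction hd : N - x using Nat.strong_induction_on generalizing x with
  | _ d ih =>
    intro hx
    rcases Nat.eq_zero_or_pos x with rfl | hpos
    · exact h0
    · refine h x hpos hx fun y hy hy' => ?_
      rcases hy' with rfl | hy'
      · exact h0
      · exact ih (N - y) (by omega) y rfl hy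

theorem lv_gt' {n x : ℕ} (h0 : 0 < x) (hx : x < 2 ^ n) (y : ℕ) : lv n x y = 0 ∨ x < lv n x y := by
  unfold lv
  rw [lvRep_of_pos_of_le h0 hx.le]
  have hb := laverStar_bounds _ _ hx y
  rcases hb.2.lt_or_eq with h | h
  · right; rw [Nat.mod_eq_of_lt h]; exact hb.1
  · left; rw [h, Nat.mod_self]

/-- Once a row has reached `0`, it starts again. -/
theorem lv_add_of_eq_zero {n x t : ℕ} (h : lv n x t = 0) (y : ℕ) : lv n x (t + y) = lv n x y := by
  induction y with
  | zero => rw [add_zero, h, lv_zero_right]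
  | succ y ih => rw [← add_assoc, lv_succ_rep, ih, ← lv_succ_rep]

theorem lv_congr_right_of {n x N : ℕ} (h : lv n x N = 0) {y y' : ℕ} (hy : y ≡ y' [MOD N]) :
    lv n x y = lv n x y' := by
  have key : ∀ k y, lv n x (N * k + y) = lv n x y := by
    intro k y
    induction k with
    | zero => simp
    | succ k ih => rw [Nat.mul_succ, add_assoc, add_comm N, ← add_assoc, add_comm _ N,
        lv_add_of_eq_zero h, ih]
  rw [← Nat.div_add_mod y N, ← Nat.div_add_mod y' N, key, key, hy]

theorem lv_sub_eq_zero {n x s t : ℕ} (hs : lv n x s = 0) (ht : lv n x t = 0) :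
    lv n x (t % s) = 0 := by
  rw [← ht]
  exact lv_congr_right_of hs (Nat.mod_modEq _ _)

/-- Passing from level `n` to level `n + 1` at most doubles the period of a row. -/
theorem lv_two_mul_eq_zero {n x t : ℕ}
    (hmod : ∀ y, lv (n + 1) x y % 2 ^ n = lv n x y) (ht : lv n x t = 0)
    (hmin : ∀ k, 0 < k → k < t → lv n x k ≠ 0) : lv (n + 1) x (2 * t) = 0 := by
  have hN : 2 ^ (n + 1) = 2 ^ n + 2 ^ n := by ring
  have pos : 0 < 2 ^ n := by positivity
  have dich : ∀ y, lv n x y = 0 → lv (n + 1) x y = 0 ∨ lv (n + 1) x y = 2 ^ n := by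
    intro y hy
    rw [← hmod] at hy
    have hlt := lv_lt (n + 1) x y
    rcases Nat.lt_or_ge (lv (n + 1) x y) (2 ^ n) with h | h
    · rw [Nat.mod_eq_of_lt h] at hy; exact Or.inl hy
    · rw [Nat.mod_eq_sub_mod h, Nat.mod_eq_of_lt (by omega)] at hy; omega
  rcases dich t ht with h | h
  · rw [two_mul, lv_add_of_eq_zero h, h]
  · have up : ∀ k, k < t → k = 0 ∨ 2 ^ n < lv (n + 1) x (t + k) := by
      intro k
      induction k with
      | zero => intro _; exact Or.inl rfl
      | succ k ih =>
        intro hk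
        right
        have hge : 2 ^ n ≤ lv (n + 1) x (t + k) := by
          rcases ih (by omega) with rfl | h'
          · simp [h]
          · exact h'.le
        have hne : lv (n + 1) x (t + (k + 1)) ≠ 0 := by
          intro h'
          apply hmin (k + 1) (by omega) hk
          rw [← lv_add_of_eq_zero ht, ← hmod, h', Nat.zero_mod]
        rw [← add_assoc, lv_succ_rep] at hne ⊢
        rcases lv_gt' (by omega) (lv_lt (n + 1) x (t + k)) (lvRep (n + 1) x % 2 ^ (n + 1) + 1)
          with h' | h'
        · exact absurd h' hne
        · omega
    rcases Nat.eq_zero_or_pos t with rfl | htpos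
    · rw [mul_zero, lv_zero_right]
    · have hge : 2 ^ n ≤ lv (n + 1) x (t + (t - 1)) := by
        rcases up (t - 1) (by omega) with h' | h'
        · rw [h', add_zero, h]
        · exact h'.le
      have e : 2 * t = t + (t - 1) + 1 := by omega
      have hz : lv n x (2 * t) = 0 := by rw [two_mul, lv_add_of_eq_zero ht, ht]
      rcases dich _ hz with h' | h'
      · exact h'
      · exfalso
        rw [e, lv_succ_rep] at h'
        rcases lv_gt' (by omega) (lv_lt (n + 1) x (t + (t - 1)))
          (lvRep (n + 1) x % 2 ^ (n + 1) + 1) with h'' | h'' <;> omega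

/-- Reduction modulo `2 ^ n`, and the fact that `2 ^ n` is a period of every row.  Both are proved
together by induction on `n`. -/
theorem lv_two_pow_and_mod (n : ℕ) :
    (∀ x, lv n x (2 ^ n) = 0) ∧ ∀ x y, lv (n + 1) x y % 2 ^ n = lv n x y := by
  have trunc : ∀ n, (∀ x, lv n x (2 ^ n) = 0) → ∀ x y, lv (n + 1) x y % 2 ^ n = lv n x y := by
    intro n hn
    have hdvd : 2 ^ n ∣ 2 ^ (n + 1) := pow_dvd_pow 2 (by omega)
    have main : ∀ x < 2 ^ (n + 1), ∀ y, lv (n + 1) x y % 2 ^ n = lv n x y := by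
      refine residue_induction ?_ ?_
      · intro y
        rw [lv_zero_left, lv_zero_left, Nat.mod_mod_of_dvd _ hdvd]
      · intro x h0 hx ih y
        induction y with
        | zero => rw [lv_zero_right, lv_zero_right, Nat.zero_mod]
        | succ y ihy =>
          rw [lv_succ_rep, ih _ (lv_lt _ _ _) (lv_gt' h0 hx y), lv_succ_rep n x,
            lvRep_of_pos_of_le h0 hx.le, Nat.mod_eq_of_lt hx]
          have h1 : lv (n + 1) x y ≡ lv n x y [MOD 2 ^ n] := by
            rw [Nat.ModEq, ihy, Nat.mod_eq_of_lt (lv_lt _ _ _)]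
          rw [lv_congr_left h1]
          refine lv_congr_right_of (hn _) ?_
          exact (((Nat.mod_modEq _ _).trans (lvRep_modEq n x)).add_right 1).symm
    intro x y
    rw [← lv_congr_left (Nat.mod_modEq x (2 ^ (n + 1))), main _ (Nat.mod_lt _ (by positivity))]
    refine lv_congr_left ?_ _
    exact (Nat.mod_modEq _ _).of_dvd hdvd
  have per : ∀ n x, lv n x (2 ^ n) = 0 := by
    intro n
    induction n with
    | zero => intro x; have := lv_lt 0 x (2 ^ 0); simpa using this
    | succ n ih =>
      intro x
      have hex : ∃ t, 0 < t ∧ lv n x t = 0 := ⟨2 ^ n, by positivity, ih x⟩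
      classical
      obtain ⟨hpos, ht⟩ := Nat.find_spec hex
      have hmin : ∀ k, 0 < k → k < Nat.find hex → lv n x k ≠ 0 :=
        fun k hk hk' h => Nat.find_min hex hk' ⟨hk, h⟩
      generalize Nat.find hex = t at hpos ht hmin
      have h2 := lv_two_mul_eq_zero (trunc n ih x) ht hmin
      have hdvd : t ∣ 2 ^ n := by
        by_contra hnd
        exact hmin (2 ^ n % t) (Nat.pos_of_ne_zero fun h => hnd (Nat.dvd_of_mod_eq_zero h))
          (Nat.mod_lt _ hpos) (lv_sub_eq_zero ht (ih x))
      obtain ⟨c, hc⟩ := hdvd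
      rw [pow_succ', hc, ← mul_assoc]
      rw [← lv_zero_right (n + 1) x]
      exact lv_congr_right_of h2 (by simp [Nat.ModEq])
  exact ⟨per n, trunc n (per n)⟩

theorem lv_congr_right {n : ℕ} (x : ℕ) {y y' : ℕ} (h : y ≡ y' [MOD 2 ^ n]) :
    lv n x y = lv n x y' := lv_congr_right_of ((lv_two_pow_and_mod n).1 x) h

theorem lv_congr {n x x' y y' : ℕ} (hx : x ≡ x' [MOD 2 ^ n]) (hy : y ≡ y' [MOD 2 ^ n]) :
    lv n x y = lv n x' y' := (lv_congr_left hx y).trans (lv_congr_right x' hy)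

theorem lv_succ (n x y : ℕ) : lv n x (y + 1) = lv n (lv n x y) (x + 1) := by
  rw [lv_succ_rep]
  exact lv_congr_right _ (((Nat.mod_modEq _ _).trans (lvRep_modEq n x)).add_right 1)

theorem lv_one (n x : ℕ) : lv n x 1 = (x + 1) % 2 ^ n := by
  rw [← zero_add 1, lv_succ, lv_zero_right, lv_zero_left]

theorem lv_mod {m n : ℕ} (h : m ≤ n) (x y : ℕ) : lv n x y % 2 ^ m = lv m x y := by
  induction n, h using Nat.le_induction with
  | base => exact Nat.mod_eq_of_lt (lv_lt _ _ _)
  | succ n hmn ih =>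
    rw [← ih, ← (lv_two_pow_and_mod n).2 x y, Nat.mod_mod_of_dvd _ (pow_dvd_pow 2 hmn)]

theorem lv_modEq {m n : ℕ} (h : m ≤ n) (x y : ℕ) : lv n x y ≡ lv m x y [MOD 2 ^ m] := by
  rw [← lv_mod h]; exact (Nat.mod_modEq _ _).symm

theorem lv_self_mod (n x y : ℕ) : lv n x y % 2 ^ n = lv n x y := Nat.mod_eq_of_lt (lv_lt _ _ _)

theorem lv_gt {n x : ℕ} (hx : x < 2 ^ n) {y : ℕ} (h : lv n x y ≠ 0) (h0 : x ≠ 0 ∨ y ≠ 0) :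
    x < lv n x y := by
  rcases Nat.eq_zero_or_pos x with rfl | hp
  · omega
  · exact (lv_gt' hp hx y).resolve_left h

/-- Left self-distributivity. -/
theorem lv_lv (n x y z : ℕ) : lv n x (lv n y z) = lv n (lv n x y) (lv n x z) := by
  have main : ∀ x < 2 ^ n, ∀ y < 2 ^ n, ∀ z,
      lv n x (lv n y z) = lv n (lv n x y) (lv n x z) := by
    refine residue_induction ?_ ?_
    · intro y _ z
      simp only [lv_zero_left]
      rw [lv_self_mod]
      exact lv_congr (Nat.mod_modEq _ _).symm (Nat.mod_modEq _ _).symm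
    intro x hx0 hx ihx
    refine residue_induction ?_ ?_
    · intro z
      rw [lv_zero_left, lv_zero_right, lv_zero_left, lv_self_mod]
      exact lv_congr_right _ (Nat.mod_modEq _ _)
    intro y hy0 hy ihy z
    induction z with
    | zero => simp [lv_zero_right]
    | succ z ihz =>
      rw [lv_succ n y, ihy _ (lv_lt _ _ _) (lv_gt' hy0 hy z), ihz, lv_succ n x y,
        lv_succ n x z]
      exact (ihx _ (lv_lt _ _ _) (lv_gt' hx0 hx y) _ (lv_lt _ _ _) _).symm
  have hm := main _ (Nat.mod_lt x (by positivity)) _ (Nat.mod_lt y (by positivity)) z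
  have hx := fun w => lv_congr_left (Nat.mod_modEq x (2 ^ n)) w
  have hy := fun w => lv_congr_left (Nat.mod_modEq y (2 ^ n)) w
  rw [hx, hy, hx, hx, lv_congr_right x (Nat.mod_modEq y (2 ^ n))] at hm
  exact hm

/-- Composition of rows: the row of `x ⋆ (q + 1) - 1` is the composite of the rows of `q` and
`x`. -/
theorem lv_comp {n x q y : ℕ} (h : y + 1 ≡ lv n x (q + 1) [MOD 2 ^ n]) (r : ℕ) :
    lv n y r = lv n x (lv n q r) := by
  induction r with
  | zero => simp [lv_zero_right]
  | succ r ih =>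
    rw [lv_succ, ih, lv_congr_right _ h, ← lv_lv, ← lv_succ]

/-! ### Periods of rows -/

/-- The row of `x` in the table of size `2 ^ n` has period `2 ^ lvOrd n x`; see `lv_eq_zero_iff`. -/
noncomputable def lvOrd (n x : ℕ) : ℕ := sInf {k | lv n x (2 ^ k) = 0}

theorem lv_two_pow_lvOrd (n x : ℕ) : lv n x (2 ^ lvOrd n x) = 0 :=
  Nat.sInf_mem (s := {k | lv n x (2 ^ k) = 0}) ⟨n, (lv_two_pow_and_mod n).1 x⟩

theorem lvOrd_le_of {n x k : ℕ} (h : lv n x (2 ^ k) = 0) : lvOrd n x ≤ k := Nat.sInf_le h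

theorem lvOrd_le (n x : ℕ) : lvOrd n x ≤ n := lvOrd_le_of ((lv_two_pow_and_mod n).1 x)

theorem lv_congr_right_ord {n x y y' : ℕ} (h : y ≡ y' [MOD 2 ^ lvOrd n x]) :
    lv n x y = lv n x y' := lv_congr_right_of (lv_two_pow_lvOrd n x) h

theorem lv_eq_zero_iff {n x y : ℕ} : lv n x y = 0 ↔ 2 ^ lvOrd n x ∣ y := by
  constructor
  · intro h
    have hex : ∃ t, 0 < t ∧ lv n x t = 0 := ⟨2 ^ lvOrd n x, by positivity, lv_two_pow_lvOrd n x⟩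
    classical
    obtain ⟨hpos, ht⟩ := Nat.find_spec hex
    have hmin : ∀ k, 0 < k → k < Nat.find hex → lv n x k ≠ 0 :=
      fun k hk hk' h => Nat.find_min hex hk' ⟨hk, h⟩
    generalize Nat.find hex = t at hpos ht hmin
    have hdvd : ∀ s, lv n x s = 0 → t ∣ s := by
      intro s hs
      by_contra hnd
      exact hmin (s % t) (Nat.pos_of_ne_zero fun h => hnd (Nat.dvd_of_mod_eq_zero h))
        (Nat.mod_lt _ hpos) (lv_sub_eq_zero ht hs)
    obtain ⟨j, -, rfl⟩ := (Nat.dvd_prime_pow Nat.prime_two).mp (hdvd _ (lv_two_pow_lvOrd n x))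
    exact (pow_dvd_pow 2 (lvOrd_le_of ht)).trans (hdvd _ h)
  · intro h
    rw [← lv_zero_right n x]
    exact lv_congr_right_ord ((Nat.modEq_zero_iff_dvd).mpr h)

theorem lvOrd_le_iff {n x k : ℕ} : lvOrd n x ≤ k ↔ lv n x (2 ^ k) = 0 := by
  rw [lv_eq_zero_iff, Nat.pow_dvd_pow_iff_le_right (by norm_num)]

theorem lvOrd_congr {n x x' : ℕ} (h : x ≡ x' [MOD 2 ^ n]) : lvOrd n x = lvOrd n x' := by
  unfold lvOrd
  simp only [lv_congr_left h]

theorem lvOrd_eq_of {n n' x x' : ℕ} (h : ∀ y, lv n x y = 0 ↔ lv n' x' y = 0) :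
    lvOrd n x = lvOrd n' x' := by
  unfold lvOrd
  simp only [h]

theorem lvOrd_zero (n : ℕ) : lvOrd n 0 = n := by
  apply le_antisymm (lvOrd_le _ _)
  have := lv_two_pow_lvOrd n 0
  rw [lv_zero_left, ← Nat.dvd_iff_mod_eq_zero, Nat.pow_dvd_pow_iff_le_right (by norm_num)] at this
  exact this

theorem lvOrd_mono {m n : ℕ} (h : m ≤ n) (x : ℕ) : lvOrd m x ≤ lvOrd n x := by
  rw [lvOrd_le_iff, ← lv_mod h, lv_two_pow_lvOrd, Nat.zero_mod]

theorem lvOrd_succ_le (n x : ℕ) : lvOrd (n + 1) x ≤ lvOrd n x + 1 := by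
  rw [lvOrd_le_iff, pow_succ']
  refine lv_two_mul_eq_zero ((lv_two_pow_and_mod n).2 x) (lv_two_pow_lvOrd n x) ?_
  intro k hk hk' h
  exact absurd (Nat.le_of_dvd hk (lv_eq_zero_iff.mp h)) (by omega)

theorem lvOrd_add_le (n k x : ℕ) : lvOrd (n + k) x ≤ lvOrd n x + k := by
  induction k with
  | zero => simp
  | succ k ih => have := lvOrd_succ_le (n + k) x; rw [← add_assoc]; omega

/-- The upper half of a table is a copy of the previous table. -/
theorem lv_top (n x y : ℕ) :
    lv (n + 1) (2 ^ n + x % 2 ^ n) y = if lv n x y = 0 then 0 else 2 ^ n + lv n x y := by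
  have hN : 2 ^ (n + 1) = 2 ^ n + 2 ^ n := by ring
  have hx := Nat.mod_lt x (by positivity : 2 ^ n > 0)
  have pos : 0 < 2 ^ n := by positivity
  have h1 := lv_mod (Nat.le_add_right n 1) (2 ^ n + x % 2 ^ n) y
  have h2 : lv n (2 ^ n + x % 2 ^ n) y = lv n x y := by
    apply lv_congr_left; simp [Nat.ModEq]
  have h3 := lv_gt' (n := n + 1) (x := 2 ^ n + x % 2 ^ n) (by omega) (by omega) y
  have h4 := lv_lt (n + 1) (2 ^ n + x % 2 ^ n) y
  rw [h2] at h1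
  rcases h3 with h3 | h3
  · rw [h3] at h1; simp [← h1, h3]
  · rw [Nat.mod_eq_sub_mod (by omega), Nat.mod_eq_of_lt (by omega)] at h1
    split_ifs <;> omega

theorem lvOrd_top (n x : ℕ) : lvOrd (n + 1) (2 ^ n + x % 2 ^ n) = lvOrd n x := by
  apply lvOrd_eq_of
  intro y
  rw [lv_top]
  split_ifs with h
  · simp [h]
  · have : 0 < 2 ^ n := by positivity
    constructor <;> intro h' <;> omega

/-- A row agrees with `k ↦ x + k` as long as the elements met have small period. -/
theorem lv_eq_add {n x b : ℕ} (h : ∀ r, 0 < r → r < b → 2 ^ lvOrd n (x + r) ∣ x) {r : ℕ}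
    (h0 : 0 < r) (hr : r ≤ b) : lv n x r = (x + r) % 2 ^ n := by
  induction r with
  | zero => omega
  | succ r ih =>
    rcases Nat.eq_zero_or_pos r with rfl | hr0
    · exact lv_one n x
    · have h1 : x + 1 ≡ 1 [MOD 2 ^ lvOrd n (x + r)] := by
        simpa using ((Nat.modEq_zero_iff_dvd).mpr (h r hr0 (by omega))).add_right 1
      rw [lv_succ, ih hr0 (by omega), lv_congr_left (Nat.mod_modEq _ _),
        lv_congr_right_ord h1, lv_one, add_assoc]

theorem lvOrd_lt {n x : ℕ} (h : ¬ 2 ^ n ∣ x) : lvOrd n x < n := by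
  induction n with
  | zero => simp at h
  | succ n ih =>
    by_cases hn : 2 ^ n ∣ x
    · obtain ⟨c, rfl⟩ := hn
      have hodd : c % 2 = 1 := by
        by_contra h'
        exact h (by rw [pow_succ]; exact Nat.mul_dvd_mul_left _ (Nat.dvd_of_mod_eq_zero (by omega)))
      have h1 : 2 ^ n * c ≡ 2 ^ n + 0 % 2 ^ n [MOD 2 ^ (n + 1)] := by
        rw [Nat.ModEq, pow_succ, Nat.mul_mod_mul_left, hodd]
        have : 0 < 2 ^ n := by positivity
        simp [Nat.mod_eq_of_lt (by omega : 2 ^ n < 2 ^ n * 2)]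
      rw [lvOrd_congr h1, lvOrd_top, lvOrd_zero]
      omega
    · have := ih hn
      have := lvOrd_succ_le n x
      omega

theorem lvOrd_eq_zero_iff {n x : ℕ} : lvOrd n x = 0 ↔ 2 ^ n ∣ x + 1 := by
  rw [← Nat.le_zero, lvOrd_le_iff, pow_zero, lv_one, Nat.dvd_iff_mod_eq_zero]

/-! ### Scaled copies of a table -/

/-- In the table of size `2 ^ (h + m)`, the multiples of `2 ^ h` form a copy of the table of size
`2 ^ m`.  This is stated through the successor only; see `LvScale.mul`. -/
def LvScale (h m : ℕ) : Prop :=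
  ∀ u, lv (h + m) (2 ^ h * u) (2 ^ h) = 2 ^ h * (u + 1) % 2 ^ (h + m)

theorem LvScale.mono {h m m' : ℕ} (H : LvScale h m) (hm : m' ≤ m) : LvScale h m' := by
  intro u
  rw [← lv_mod (by omega : h + m' ≤ h + m), H, Nat.mod_mod_of_dvd _ (pow_dvd_pow 2 (by omega))]

theorem lvScale_zero_left (m : ℕ) : LvScale 0 m := by
  intro u; simp [lv_one]

theorem lvScale_one (h : ℕ) : LvScale h 1 := by
  intro u
  rcases Nat.even_or_odd u with ⟨c, rfl⟩ | ⟨c, rfl⟩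
  · have h1 : 2 ^ h * (c + c) ≡ 0 [MOD 2 ^ (h + 1)] := by
      rw [Nat.modEq_zero_iff_dvd, pow_succ]
      exact Nat.mul_dvd_mul_left _ ⟨c, by ring⟩
    rw [lv_congr_left h1, lv_zero_left]
    have := h1.add_right (2 ^ h)
    rw [zero_add] at this
    rw [mul_add, mul_one, this]
  · have h1 : 2 ^ h * (2 * c + 1) ≡ 2 ^ h + 0 % 2 ^ h [MOD 2 ^ (h + 1)] := by
      rw [Nat.ModEq, pow_succ, Nat.mul_mod_mul_left]
      have : 0 < 2 ^ h := by positivity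
      simp [Nat.add_mod, Nat.mod_eq_of_lt (by omega : 2 ^ h < 2 ^ h * 2)]
    rw [lv_congr_left h1, lv_top, lv_zero_left, Nat.mod_self, if_pos rfl]
    symm
    rw [← Nat.dvd_iff_mod_eq_zero, pow_succ]
    exact Nat.mul_dvd_mul_left _ ⟨c + 1, by ring⟩

/-- From the copy of size `2 ^ m` to the one of size `2 ^ (m + 1)`, for the rows beyond
`2 ^ h * J`.  The right arguments need no such restriction, because a nonzero row at level
`h + (m + 1)` depends on its argument modulo `2 ^ (h + m)` only. -/
theorem LvScale.rows {h m J : ℕ} (H : LvScale h m)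
    (hJ : ∀ j, J ≤ j → j < 2 ^ (m + 1) →
      lv (h + (m + 1)) (2 ^ h * j) (2 ^ h) = 2 ^ h * (j + 1) % 2 ^ (h + (m + 1))) :
    ∀ j < 2 ^ (m + 1), (j = 0 ∨ J ≤ j) → ∀ t,
      lv (h + (m + 1)) (2 ^ h * j) (2 ^ h * t) = 2 ^ h * lv (m + 1) j t := by
  refine residue_induction ?_ ?_
  · intro _ t
    rw [mul_zero, lv_zero_left, lv_zero_left, pow_add, Nat.mul_mod_mul_left]
  · intro j hj0 hj ih hor t
    have hJj : J ≤ j := by omega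
    induction t with
    | zero => simp [lv_zero_right]
    | succ t iht =>
      have hord : lvOrd (h + (m + 1)) (2 ^ h * j) ≤ h + m := by
        refine Nat.le_of_lt_succ (lvOrd_lt ?_)
        rw [pow_add, Nat.mul_dvd_mul_iff_left (by positivity)]
        intro hd
        exact absurd (Nat.le_of_dvd hj0 hd) (by omega)
      have h1 : 2 ^ h * (t + 1) ≡ lv (h + (m + 1)) (2 ^ h * t) (2 ^ h)
          [MOD 2 ^ lvOrd (h + (m + 1)) (2 ^ h * j)] := by
        refine Nat.ModEq.of_dvd (pow_dvd_pow 2 hord) ?_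
        refine Nat.ModEq.symm ((lv_modEq (by omega) _ _).trans ?_)
        rw [H]
        exact Nat.mod_modEq _ _
      rw [lv_congr_right_ord h1, lv_lv, iht, hJ j hJj hj, lv_congr_right _ (Nat.mod_modEq _ _),
        ih _ (lv_lt _ _ _) (lv_gt' hj0 hj t), ← lv_succ]
      rcases lv_gt' hj0 hj t with h' | h' <;> omega

/-- If the rows of the multiples of `2 ^ h` beyond `2 ^ h * j` are scaled, so is the row of
`2 ^ h * (j + 1) - 1`. -/
theorem lv_pred_of_rows {h M j y : ℕ} (hj : j < 2 ^ M)
    (H : ∀ j' < 2 ^ M, (j' = 0 ∨ j + 1 ≤ j') → ∀ t,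
      lv (h + M) (2 ^ h * j') (2 ^ h * t) = 2 ^ h * lv M j' t)
    (hy : y + 1 = 2 ^ h * (j + 1)) (k : ℕ) : lv (h + M) y k = 2 ^ h * lv M j k := by
  induction k with
  | zero => simp [lv_zero_right]
  | succ k ih =>
    rw [lv_succ, ih, hy, H _ (lv_lt _ _ _), ← lv_succ]
    rcases Nat.eq_zero_or_pos j with rfl | h0
    · omega
    · exact lv_gt' h0 hj k

/-- The multiples of `2 ^ h` form a copy of the smaller table. -/
theorem LvScale.mul {h m : ℕ} (H : LvScale h m) (u t : ℕ) :
    lv (h + m) (2 ^ h * u) (2 ^ h * t) = 2 ^ h * lv m u t := by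
  rcases m with _ | m
  · have h1 : 2 ^ h * u ≡ 0 [MOD 2 ^ (h + 0)] := by simp [Nat.ModEq]
    have h2 := lv_lt 0 u t
    rw [lv_congr_left h1, lv_zero_left]
    simp at h2 ⊢
    exact h2
  · have h1 : 2 ^ h * u ≡ 2 ^ h * (u % 2 ^ (m + 1)) [MOD 2 ^ (h + (m + 1))] := by
      rw [pow_add]
      exact (Nat.mod_modEq u _).symm.mul_left' _
    rw [lv_congr_left h1, LvScale.rows (J := 0) (H.mono (Nat.le_succ m)) (fun j _ _ => H j) _
      (Nat.mod_lt _ (by positivity)) (Or.inr (Nat.zero_le _)), lv_congr_left (Nat.mod_modEq _ _)]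

theorem LvScale.pred {h m : ℕ} (H : LvScale h m) {j y : ℕ} (hj : j < 2 ^ m)
    (hy : y + 1 = 2 ^ h * (j + 1)) (k : ℕ) : lv (h + m) y k = 2 ^ h * lv m j k :=
  lv_pred_of_rows hj (fun j' _ _ t => H.mul j' t) hy k

theorem lvOrd_eq_of_scaled {h M j y : ℕ} (H : ∀ k, lv (h + M) y k = 2 ^ h * lv M j k) :
    lvOrd (h + M) y = lvOrd M j := by
  apply lvOrd_eq_of
  intro k
  rw [H]
  simp

theorem LvScale.lvOrd_pred {h m : ℕ} (H : LvScale h m) {j y : ℕ} (hj : j < 2 ^ m)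
    (hy : y + 1 = 2 ^ h * (j + 1)) : lvOrd (h + m) y = lvOrd m j :=
  lvOrd_eq_of_scaled (H.pred hj hy)

theorem LvScale.lvOrd_mul_le {h m : ℕ} (H : LvScale h m) {u i : ℕ} (hu : lvOrd m u ≤ i) :
    lvOrd (h + m) (2 ^ h * u) ≤ h + i := by
  rw [lvOrd_le_iff] at hu ⊢
  rw [pow_add, H.mul, hu, mul_zero]

theorem LvScale.comp {h m t m' : ℕ} (H : LvScale h m) (H' : LvScale t m') (hm : t + m' ≤ m) :
    LvScale (h + t) m' := by
  intro u
  have := (H.mono hm).mul (2 ^ t * u) (2 ^ t)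
  rw [H'] at this
  rw [add_assoc, pow_add 2 h t, pow_add 2 h (t + m'), mul_assoc, mul_assoc, this,
    Nat.mul_mod_mul_left]

/-! ### Bounding periods -/

/-- If `x ⋆ q` has period at most `2 ^ l`, then so has `x`, provided that `q` is suited to the
period of `x` modulo `2 ^ l`. -/
theorem lvOrd_le_of_lv {n l i x q : ℕ} (h1 : lvOrd l x ≤ i) (h2 : lv (l + 1) q (2 ^ i) ≠ 0)
    (h3 : lvOrd n (lv n x q) ≤ l) : lvOrd n x ≤ l := by
  by_contra hcon
  have hn : l + 1 ≤ n := by have := lvOrd_le n x; omega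
  have h4 : 2 ^ l ∣ lv n x (2 ^ i) := by
    rw [Nat.dvd_iff_mod_eq_zero, lv_mod (by omega)]
    exact lvOrd_le_iff.mp h1
  have h5 : lv n x (lv n q (2 ^ i)) = 0 := by
    rw [lv_lv, lv_eq_zero_iff]
    exact (pow_dvd_pow 2 h3).trans h4
  rw [lv_eq_zero_iff] at h5
  apply h2
  rw [← lv_mod hn, ← Nat.dvd_iff_mod_eq_zero]
  exact (pow_dvd_pow 2 (by omega)).trans h5

/-- For every exponent `d` between `1` and `l - 1` there is an element `q` to which
`lvOrd_le_of_lv` applies with `i ≥ d`, while `x ⋆ q` is nonzero modulo `2 ^ l` for `x` of period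
`2 ^ d`. -/
def LvSupply (l : ℕ) : Prop :=
  ∀ d, 0 < d → d < l → ∃ q i, d ≤ i ∧ ¬ 2 ^ d ∣ q ∧ lv (l + 1) q (2 ^ i) ≠ 0

theorem lvSupply_of_lvScale {D : ℕ}
    (H : ∀ h < 2 ^ D, ∀ s, 2 ^ s ∣ h → LvScale h (2 * 2 ^ s)) : LvSupply (2 ^ D) := by
  intro d hd0 hd
  -- `2 ^ b` is the largest power of two that is at most `l - d`
  set b := Nat.log 2 (2 ^ D - d) with hb
  have hb1 : 2 ^ b ≤ 2 ^ D - d := Nat.pow_log_le_self 2 (by omega)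
  have hb2 : 2 ^ D - d < 2 ^ (b + 1) := Nat.lt_pow_succ_log_self (by norm_num) _
  have hbD : b < D := by
    rw [← Nat.pow_lt_pow_iff_right (by norm_num : 1 < 2)]; omega
  have hle : 2 ^ (b + 1) ≤ 2 ^ D := Nat.pow_le_pow_right (by norm_num) hbD
  have hp : 2 ^ (b + 1) = 2 * 2 ^ b := by ring
  have hbpos : 0 < 2 ^ b := by positivity
  set c := 2 ^ D - 2 ^ (b + 1) with hc
  have hcb : 2 ^ (b + 1) ∣ c := Nat.dvd_sub (pow_dvd_pow 2 hbD) dvd_rfl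
  have Hc : LvScale c (2 * 2 ^ b + 1) := (H c (by omega) (b + 1) hcb).mono (by omega)
  have Hb : LvScale (2 ^ b) (2 ^ b + 1) := (H (2 ^ b) (by omega) b dvd_rfl).mono (by omega)
  have hpos : 0 < 2 ^ 2 ^ b := by positivity
  refine ⟨2 ^ c * (2 ^ 2 ^ b - 1), c + 2 ^ b, by omega, ?_, ?_⟩
  · intro hdvd
    have : 2 ^ (c + 1) ∣ 2 ^ c * (2 ^ 2 ^ b - 1) := (pow_dvd_pow 2 (by omega)).trans hdvd
    rw [pow_succ, Nat.mul_dvd_mul_iff_left (by positivity)] at this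
    have h2 : 2 ∣ 2 ^ 2 ^ b := dvd_pow_self 2 (by omega)
    omega
  · have e : 2 ^ D + 1 = c + (2 * 2 ^ b + 1) := by omega
    rw [e, pow_add 2 c (2 ^ b), Hc.mul]
    have e2 : 2 * 2 ^ b + 1 = 2 ^ b + (2 ^ b + 1) := by omega
    rw [e2, Hb.pred (j := 0) (by positivity) (by omega), lv_zero_left,
      Nat.mod_eq_of_lt (Nat.pow_lt_pow_right (by norm_num) (by omega))]
    positivity

/-- If `LvSupply l`, elements not divisible by `2 ^ l` have period at most `2 ^ l` in all tables of
size at most `2 ^ (2 * l)`. -/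
theorem lvOrd_le_of_not_dvd {l n : ℕ} (hs : LvSupply l) (hn : n ≤ 2 * l) {x : ℕ}
    (hx : ¬ 2 ^ l ∣ x) : lvOrd n x ≤ l := by
  rcases Nat.lt_or_ge n l with hnl | hnl
  · exact (lvOrd_le n x).trans hnl.le
  have hdvd : 2 ^ l ∣ 2 ^ n := pow_dvd_pow 2 hnl
  have main : ∀ x < 2 ^ n, ¬ 2 ^ l ∣ x → lvOrd n x ≤ l := by
    refine residue_induction (fun h => absurd (dvd_zero _) h) ?_
    intro x h0 hx ih hl
    rcases Nat.eq_zero_or_pos (lvOrd l x) with hd | hd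
    · have := lvOrd_add_le l (n - l) x
      rw [Nat.add_sub_cancel' hnl] at this
      omega
    · obtain ⟨q, i, h1, h2, h3⟩ := hs _ hd (lvOrd_lt hl)
      refine lvOrd_le_of_lv h1 h3 (ih _ (lv_lt _ _ _) (lv_gt' h0 hx q) ?_)
      rwa [Nat.dvd_iff_mod_eq_zero, lv_mod hnl, lv_eq_zero_iff]
  rw [← lvOrd_congr (Nat.mod_modEq x _)]
  refine main _ (Nat.mod_lt _ (by positivity)) ?_
  rwa [Nat.dvd_mod_iff hdvd]

/-! ### Which scaled copies exist -/

theorem le_of_two_pow_dvd_mul_odd {a b c : ℕ} (hc : c % 2 = 1) (h : 2 ^ a ∣ 2 ^ b * c) :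
    a ≤ b := by
  rw [← Nat.pow_dvd_pow_iff_le_right (by norm_num : 1 < 2)]
  refine Nat.Coprime.dvd_of_dvd_mul_right (Nat.Coprime.pow_left _ ?_) h
  exact (Nat.coprime_two_left).mpr (Nat.odd_iff.mpr hc)

/-- If `LvSupply l`, a bound for the periods of the elements following an even multiple of
`2 ^ l`.  Induction on `r` makes `J ⋆ r = J + r` available for that multiple `J`, and then left
distributivity compares `(J + r) ⋆ (J ⋆ 2 ^ k)` with `J ⋆ (r ⋆ 2 ^ k)`. -/
theorem lvOrd_le_add_of_even {l m : ℕ} (hs : LvSupply l) (hm : m + 1 ≤ 2 * l)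
    (H : LvScale l m) {e c : ℕ} (he : 0 < e) (hc : c % 2 = 1) (hj : 2 ^ e * c < 2 ^ (m + 1)) :
    ∀ r, 0 < r → r < 2 ^ l → lvOrd (l + (m + 1)) (2 ^ l * (2 ^ e * c) + r) ≤ l + e := by
  intro r
  induction r using Nat.strong_induction_on with
  | _ r ih =>
    intro h0 hr
    set J := 2 ^ l * (2 ^ e * c) with hJ
    set n := l + (m + 1) with hn
    have hcpos : 0 < c := by omega
    have hem : e < m + 1 := by
      rw [← Nat.pow_lt_pow_iff_right (by norm_num : 1 < 2)]
      exact (Nat.le_mul_of_pos_right _ hcpos).trans_lt hj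
    have hdvdJ : 2 ^ (l + e) ∣ J := ⟨c, by rw [hJ, pow_add, mul_assoc]⟩
    have hx : J + r ≡ lv n J r [MOD 2 ^ n] := by
      rw [lv_eq_add (b := r) _ h0 le_rfl]
      · exact (Nat.mod_modEq _ _).symm
      · intro r' h0' hr'
        exact (pow_dvd_pow 2 (ih r' hr' h0' (by omega))).trans hdvdJ
    -- the exponent `k = l + e - 1` is the one for which `J ⋆ 2 ^ k` has valuation exactly `k`
    obtain ⟨e', rfl⟩ : ∃ e', e = e' + 1 := ⟨e - 1, by omega⟩
    have hval : ¬ 2 ^ (l + e' + 1) ∣ lv (l + m) J (2 ^ (l + e')) := by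
      rw [Nat.dvd_iff_mod_eq_zero, lv_mod (by omega),
        lv_congr_left ((Nat.modEq_zero_iff_dvd).mpr (by rwa [add_assoc])), lv_zero_left,
        Nat.mod_eq_of_lt (Nat.pow_lt_pow_right (by norm_num) (by omega))]
      positivity
    have hdiv : 2 ^ (l + e') ∣ lv (l + m) J (2 ^ (l + e')) := by
      rw [Nat.dvd_iff_mod_eq_zero, lv_mod (by omega),
        lv_congr_left ((Nat.modEq_zero_iff_dvd).mpr ((pow_dvd_pow 2 (by omega)).trans hdvdJ)),
        lv_zero_left, Nat.mod_self]
    have hzero : lv (l + m) J (lv (l + m) r (2 ^ (l + e'))) = 0 := by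
      have hr1 : ¬ 2 ^ l ∣ r := fun h => absurd (Nat.le_of_dvd h0 h) (by omega)
      have hr2 : lvOrd (2 * l) r ≤ l := lvOrd_le_of_not_dvd hs le_rfl hr1
      have hJord : lvOrd (l + m) J ≤ 2 * l + e' := by
        rw [two_mul, add_assoc]
        refine H.lvOrd_mul_le ?_
        by_cases hd : 2 ^ l ∣ 2 ^ (e' + 1) * c
        · have hle : l ≤ e' + 1 := le_of_two_pow_dvd_mul_odd hc hd
          have := lvOrd_le m (2 ^ (e' + 1) * c)
          omega
        · have := lvOrd_le_of_not_dvd hs (n := m) (by omega) hd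
          omega
      rw [lv_eq_zero_iff]
      rcases Nat.lt_or_ge (2 * l + e') (l + m) with hlt | hge
      · refine (pow_dvd_pow 2 hJord).trans ?_
        rw [Nat.dvd_iff_mod_eq_zero, lv_mod hlt.le, ← lvOrd_le_iff]
        have := lvOrd_add_le (2 * l) e' r
        omega
      · have : lv (l + m) r (2 ^ (l + e')) = 0 := by
          rw [← lvOrd_le_iff]
          have h1 := lvOrd_add_le (2 * l) e' r
          have h2 := lvOrd_mono hge r
          omega
        rw [this]
        exact dvd_zero _
    have hx' : lv (l + m) J r ≡ J + r [MOD 2 ^ (l + m)] :=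
      ((lv_modEq (by omega : l + m ≤ n) J r).symm.trans
        (hx.symm.of_dvd (pow_dvd_pow 2 (by omega))))
    rw [lv_lv, lv_congr_left hx', lv_eq_zero_iff] at hzero
    have hle : lvOrd (l + m) (J + r) ≤ l + e' := by
      by_contra hcon
      exact hval ((pow_dvd_pow 2 (by omega)).trans hzero)
    have := lvOrd_succ_le (l + m) (J + r)
    rw [hn, ← add_assoc l m 1]
    omega

theorem add_le_of_dvd_of_lt {d a b : ℕ} (ha : d ∣ a) (hb : d ∣ b) (h : a < b) : a + d ≤ b := by
  have := Nat.le_of_dvd (by omega) (Nat.dvd_sub hb ha)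
  omega

/-- Doubling the size of the copy, if `LvSupply l`.  The multiples `2 ^ l * j` are treated by
descending induction on `j`; for `j` odd the bound is that of `lvOrd_le_of_lv`, except at the last
element before the next multiple, whose row is known exactly. -/
theorem LvScale.step {l m : ℕ} (hl : 0 < l) (hs : LvSupply l) (hm : m + 1 ≤ 2 * l)
    (H : LvScale l m) : LvScale l (m + 1) := by
  have hl1 : 1 < 2 ^ l := Nat.one_lt_two_pow hl.ne'
  have exact_of : ∀ j, (∀ r, 0 < r → r < 2 ^ l →
      2 ^ lvOrd (l + (m + 1)) (2 ^ l * j + r) ∣ 2 ^ l * j) →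
      lv (l + (m + 1)) (2 ^ l * j) (2 ^ l) = 2 ^ l * (j + 1) % 2 ^ (l + (m + 1)) := by
    intro j hj
    rw [lv_eq_add (b := 2 ^ l) hj (by positivity) le_rfl, mul_add, mul_one]
  have key : ∀ j < 2 ^ (m + 1), j = 0 ∨ ∀ r, 0 < r → r < 2 ^ l →
      2 ^ lvOrd (l + (m + 1)) (2 ^ l * j + r) ∣ 2 ^ l * j := by
    refine residue_induction (Or.inl rfl) ?_
    intro j hj0 hj ih
    right
    obtain ⟨e, c, hc, rfl⟩ := Nat.exists_eq_two_pow_mul_odd hj0.ne'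
    rw [Nat.odd_iff] at hc
    rcases Nat.eq_zero_or_pos e with rfl | he
    swap
    · intro r h0 hr
      refine (pow_dvd_pow 2 (lvOrd_le_add_of_even hs hm H he hc hj r h0 hr)).trans ⟨c, ?_⟩
      rw [pow_add, mul_assoc]
    rw [pow_zero, one_mul] at *
    suffices hle : ∀ k r, k = 2 ^ l - r → 0 < r → r < 2 ^ l →
        lvOrd (l + (m + 1)) (2 ^ l * c + r) ≤ l from
      fun r h0 hr => (pow_dvd_pow 2 (hle _ r rfl h0 hr)).trans (dvd_mul_right _ _)
    intro k
    induction k using Nat.strong_induction_on with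
    | _ k ihk =>
      intro r hk h0 hr
      have hrow := H.rows (J := c + 1) fun j' h1 h2 => exact_of j'
        ((ih j' h2 (Or.inr (by omega))).resolve_left (by omega))
      rcases (by omega : r + 1 = 2 ^ l ∨ r + 1 < 2 ^ l) with hr1 | hr1
      · rw [lvOrd_eq_of_scaled (lv_pred_of_rows hj hrow (by rw [add_assoc, hr1]; ring))]
        refine lvOrd_le_of_not_dvd hs hm fun h => ?_
        have := (dvd_pow_self 2 hl.ne').trans h
        omega
      · have hxr : 2 ^ l * c + r ≡ r [MOD 2 ^ l] := by simp [Nat.ModEq]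
        have hd : lvOrd l r ≠ 0 := by
          rw [Ne, lvOrd_eq_zero_iff]
          exact fun h => absurd (Nat.le_of_dvd (by omega) h) (by omega)
        have hd' : lvOrd l r < l :=
          lvOrd_lt fun h => absurd (Nat.le_of_dvd h0 h) (by omega)
        obtain ⟨q, i, h1, h2, h3⟩ := hs _ (Nat.pos_of_ne_zero hd) hd'
        refine lvOrd_le_of_lv ((lvOrd_congr hxr).le.trans h1) h3 ?_
        have hne : lv l r q ≠ 0 := by rwa [Ne, lv_eq_zero_iff]
        -- the element `x ⋆ q` again has an odd quotient by `2 ^ l`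
        have hz1 : lv (l + (m + 1)) (2 ^ l * c + r) q % 2 ^ (l + 1) = 2 ^ l + lv l r q := by
          rw [lv_mod (by omega), lv_congr_left (x' := 2 ^ l + r % 2 ^ l), lv_top, if_neg hne]
          rw [Nat.mod_eq_of_lt hr]
          refine Nat.ModEq.add_right r ?_
          rw [Nat.ModEq, pow_succ, Nat.mul_mod_mul_left, hc, mul_one, Nat.mod_eq_of_lt (by omega)]
        have hzlt := lv_lt (l + (m + 1)) (2 ^ l * c + r) q
        have hxlt : 2 ^ l * c + r < 2 ^ (l + (m + 1)) := by
          rw [pow_add]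
          have := Nat.mul_le_mul_left (2 ^ l) (show c + 1 ≤ 2 ^ (m + 1) from hj)
          rw [mul_add] at this
          omega
        have hzgt := lv_gt hxlt (y := q) (by intro h; rw [h] at hz1; simp at hz1; omega)
          (Or.inl (by omega))
        set z := lv (l + (m + 1)) (2 ^ l * c + r) q with hz
        have hrlt := lv_lt l r q
        set r' := lv l r q with hr'
        obtain ⟨a, ha⟩ : ∃ a, z = 2 ^ l * (2 * a + 1) + r' := by
          refine ⟨z / 2 ^ (l + 1), ?_⟩
          conv_lhs => rw [← Nat.div_add_mod z (2 ^ (l + 1)), hz1]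
          ring
        rw [ha] at hzlt hzgt ⊢
        have hca : c ≤ 2 * a + 1 := by
          by_contra hcon
          have := Nat.mul_le_mul_left (2 ^ l) (show 2 * a + 1 + 1 ≤ c by omega)
          rw [mul_add] at this
          omega
        rcases hca.eq_or_lt with hca | hca
        · rw [← hca] at hzgt ⊢
          exact ihk (2 ^ l - r') (by omega) r' rfl (by omega) hrlt
        · have halt : 2 * a + 1 < 2 ^ (m + 1) := by
            rw [pow_add 2 l] at hzlt
            by_contra hcon
            have := Nat.mul_le_mul_left (2 ^ l) (not_lt.mp hcon)
            omega
          have := (ih _ halt (Or.inr hca)).resolve_left (by omega) r' (by omega) hrlt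
          exact le_of_two_pow_dvd_mul_odd (by omega) this
  intro u
  have hu : 2 ^ l * u ≡ 2 ^ l * (u % 2 ^ (m + 1)) [MOD 2 ^ (l + (m + 1))] := by
    rw [pow_add]
    exact (Nat.mod_modEq u _).symm.mul_left' _
  have hu' : 2 ^ l * (u + 1) ≡ 2 ^ l * (u % 2 ^ (m + 1) + 1) [MOD 2 ^ (l + (m + 1))] := by
    rw [pow_add]
    exact ((Nat.mod_modEq u _).symm.add_right 1).mul_left' _
  rw [lv_congr_left hu, hu']
  rcases key _ (Nat.mod_lt u (by positivity)) with h | h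
  · rw [h, mul_zero, lv_zero_left, zero_add, mul_one]
  · exact exact_of _ h

/-- The multiples of `2 ^ h` in the table of size `2 ^ (h + 2 * 2 ^ s)` form a copy of the table of
size `2 ^ (2 * 2 ^ s)` whenever `2 ^ s` divides `h`. -/
theorem lvScale_of_dvd (h s : ℕ) (hs : 2 ^ s ∣ h) : LvScale h (2 * 2 ^ s) := by
  induction h using Nat.strong_induction_on generalizing s with
  | _ h ih =>
    rcases Nat.eq_zero_or_pos h with rfl | h0
    · exact lvScale_zero_left _
    set D := Nat.log 2 h with hD
    have hD1 : 2 ^ D ≤ h := Nat.pow_log_le_self 2 h0.ne'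
    have hD2 : h < 2 ^ (D + 1) := Nat.lt_pow_succ_log_self (by norm_num) _
    have hp : 2 ^ (D + 1) = 2 * 2 ^ D := by ring
    have hsD : s ≤ D := by
      have := (Nat.le_of_dvd h0 hs).trans_lt hD2
      rw [Nat.pow_lt_pow_iff_right (by norm_num)] at this
      omega
    have hsup : LvSupply (2 ^ D) :=
      lvSupply_of_lvScale fun h' hh' s' hs' => ih h' (by omega) s' hs'
    have hpow : ∀ m, m ≤ 2 * 2 ^ D → LvScale (2 ^ D) m := by
      intro m
      induction m with
      | zero => exact fun _ => (lvScale_one _).mono (by omega)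
      | succ m ihm => exact fun hm => (ihm (by omega)).step (by positivity) hsup hm
    have hsle : 2 ^ s ≤ 2 ^ D := Nat.pow_le_pow_right (by norm_num) hsD
    rcases hD1.eq_or_lt with heq | hlt
    · rw [← heq]
      exact hpow _ (by omega)
    · have hst : 2 ^ s ∣ h - 2 ^ D := Nat.dvd_sub hs (pow_dvd_pow 2 hsD)
      have hle : h - 2 ^ D + 2 ^ s ≤ 2 ^ D :=
        add_le_of_dvd_of_lt hst (pow_dvd_pow 2 hsD) (by omega)
      have hpos : 0 < 2 ^ D := by positivity
      have := (hpow _ le_rfl).comp (ih (h - 2 ^ D) (by omega) s hst) (by omega)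
      rwa [Nat.add_sub_cancel' hD1] at this

theorem lvSupply_two_pow (D : ℕ) : LvSupply (2 ^ D) :=
  lvSupply_of_lvScale fun h _ s hs => lvScale_of_dvd h s hs

/-- The bound `2 * 2 ^ s` of `lvScale_of_dvd` is sharp when `h` is an odd multiple of `2 ^ s`. -/
theorem lvOrd_pred_two_pow_le {s c : ℕ} (hc : c % 2 = 1) :
    lvOrd (2 ^ s * c + (2 * 2 ^ s + 1)) (2 ^ (2 ^ s * c) - 1) ≤ 2 * 2 ^ s := by
  obtain ⟨d, rfl⟩ : ∃ d, c = 2 * d + 1 := ⟨c / 2, by omega⟩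
  have hpos : 0 < 2 ^ s := by positivity
  have hp : 2 ^ (s + 1) = 2 * 2 ^ s := by ring
  have e1 : 2 ^ s * (2 * d + 1) + (2 * 2 ^ s + 1) = 2 ^ (s + 1) * d + (3 * 2 ^ s + 1) := by
    rw [hp]; ring
  have e2 : 2 ^ s * (2 * d + 1) = 2 ^ (s + 1) * d + 2 ^ s := by rw [hp]; ring
  have H : LvScale (2 ^ (s + 1) * d) (3 * 2 ^ s + 1) :=
    (lvScale_of_dvd _ (s + 1) (dvd_mul_right _ _)).mono (by omega)
  have hlt : 2 ^ 2 ^ s < 2 ^ (3 * 2 ^ s + 1) := Nat.pow_lt_pow_right (by norm_num) (by omega)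
  have hone : 1 < 2 ^ 2 ^ s := Nat.one_lt_two_pow hpos.ne'
  rw [e1, H.lvOrd_pred (j := 2 ^ 2 ^ s - 1) (by omega), ← hp]
  · refine lvOrd_le_of_not_dvd (lvSupply_two_pow _) (by omega) ?_
    intro h
    have h1 := Nat.le_of_dvd (by omega) h
    have h2 : 2 ^ 2 ^ s ≤ 2 ^ 2 ^ (s + 1) :=
      Nat.pow_le_pow_right (by norm_num) (Nat.pow_le_pow_right (by norm_num) (by omega))
    omega
  · rw [Nat.sub_add_cancel Nat.one_le_two_pow, Nat.sub_add_cancel Nat.one_le_two_pow, e2, pow_add]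

/-! ### Bounding periods in a residue class -/

theorem two_pow_mul_pred_add (a g : ℕ) : 2 ^ a * (2 ^ g - 1) + 2 ^ a = 2 ^ (a + g) := by
  have : 0 < 2 ^ g := by positivity
  obtain ⟨k, hk⟩ : ∃ k, 2 ^ g = k + 1 := ⟨2 ^ g - 1, by omega⟩
  rw [pow_add, hk, Nat.add_sub_cancel, mul_add, mul_one]

/-- The top `2 ^ a` elements of the table of size `2 ^ (a + g)` form a copy of the table of size
`2 ^ a`. -/
theorem lv_ones_top (a g : ℕ) {r : ℕ} (hr : r < 2 ^ a) (q : ℕ) :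
    lv (a + g) (2 ^ a * (2 ^ g - 1) + r) q =
      if lv a r q = 0 then 0 else 2 ^ a * (2 ^ g - 1) + lv a r q := by
  induction g with
  | zero => simp +contextual
  | succ g ih =>
    have hpos : 0 < 2 ^ g := by positivity
    have hlt : 2 ^ a * (2 ^ g - 1) + r < 2 ^ (a + g) := by
      rw [pow_add]
      have := two_pow_mul_pred_add a g
      rw [pow_add] at this
      omega
    have e : 2 ^ a * (2 ^ (g + 1) - 1) = 2 ^ (a + g) + 2 ^ a * (2 ^ g - 1) := by
      rw [pow_add 2 a g, ← mul_add, pow_succ]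
      congr 1
      omega
    have := lv_top (a + g) (2 ^ a * (2 ^ g - 1) + r) q
    rw [Nat.mod_eq_of_lt hlt, ih] at this
    rw [e, add_assoc, ← add_assoc a g 1, this]
    split_ifs <;> omega

theorem lvOrd_ones_top (a g : ℕ) {r : ℕ} (hr : r < 2 ^ a) :
    lvOrd (a + g) (2 ^ a * (2 ^ g - 1) + r) = lvOrd a r := by
  apply lvOrd_eq_of
  intro q
  rw [lv_ones_top a g hr]
  split_ifs <;> simp_all

/-- In the table of size `2 ^ (a + g + (m + 1))`, elements congruent modulo `2 ^ (a + g)` to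
`2 ^ a * (2 ^ g - 1) + r` with `0 < r < 2 ^ a` have period at most `2 ^ a`.  The induction runs
over the binary expansion of `a`: the sum `c` of the leading terms of it is a lower bound for the
valuation of the element, and `a'` is the remaining part. -/
theorem lvOrd_le_of_class_aux {s m g a : ℕ} (hm : m + 1 ≤ 2 ^ (s + 1)) (a' : ℕ) :
    ∀ c D, a = c + a' → a' < 2 ^ D → 2 ^ D ∣ c → 2 ^ (s + 1) ∣ a' →
    ∀ y r, y ≡ 2 ^ a * (2 ^ g - 1) + r [MOD 2 ^ (a + g)] → 0 < r → r < 2 ^ a → 2 ^ c ∣ y →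
      lvOrd (a + g + (m + 1)) y ≤ a := by
  induction a' using Nat.strong_induction_on with
  | _ a' ih =>
    intro c D hac haD hcD hsa y r hy hr0 hr hcy
    have hmodr : ∀ y r, y ≡ 2 ^ a * (2 ^ g - 1) + r [MOD 2 ^ (a + g)] → y ≡ r [MOD 2 ^ a] := by
      intro y r h
      refine (h.of_dvd (pow_dvd_pow 2 (by omega))).trans ?_
      simp [Nat.ModEq]
    rcases Nat.eq_zero_or_pos a' with rfl | ha'
    · exfalso
      have h1 := hmodr y r hy
      rw [hac, add_zero] at h1 hr
      have : 2 ^ c ∣ r := (h1.dvd_iff dvd_rfl).mp hcy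
      exact absurd (Nat.le_of_dvd hr0 this) (by omega)
    set E := Nat.log 2 a' with hE
    have hE1 : 2 ^ E ≤ a' := Nat.pow_log_le_self 2 ha'.ne'
    have hE2 : a' < 2 ^ (E + 1) := Nat.lt_pow_succ_log_self (by norm_num) _
    have hp : 2 ^ (E + 1) = 2 * 2 ^ E := by ring
    have hED : E + 1 ≤ D := by
      have := hE1.trans_lt haD
      rw [Nat.pow_lt_pow_iff_right (by norm_num)] at this
      omega
    have hsE : s + 1 ≤ E := by
      have := (Nat.le_of_dvd ha' hsa).trans_lt hE2
      rw [Nat.pow_lt_pow_iff_right (by norm_num)] at this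
      omega
    have hsl : 2 ^ (s + 1) ∣ 2 ^ E := pow_dvd_pow 2 hsE
    have hEc : 2 ^ (E + 1) ∣ c := (pow_dvd_pow 2 hED).trans hcD
    have hsr : 2 ^ (s + 1) ∣ a' - 2 ^ E := Nat.dvd_sub hsa hsl
    by_cases hcl : 2 ^ (c + 2 ^ E) ∣ y
    · have hpos : 0 < 2 ^ E := by positivity
      exact ih (a' - 2 ^ E) (by omega) (c + 2 ^ E) E (by omega) (by omega)
        (Nat.dvd_add ((pow_dvd_pow 2 (by omega)).trans hEc) dvd_rfl) hsr y r hy hr0 hr hcl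
    have hrl : a' - 2 ^ E + 2 ^ (s + 1) ≤ 2 ^ E := add_le_of_dvd_of_lt hsr hsl (by omega)
    clear ih
    suffices main : ∀ y < 2 ^ (a + g + (m + 1)), ∀ r,
        y ≡ 2 ^ a * (2 ^ g - 1) + r [MOD 2 ^ (a + g)] → 0 < r → r < 2 ^ a → 2 ^ c ∣ y →
        ¬ 2 ^ (c + 2 ^ E) ∣ y → lvOrd (a + g + (m + 1)) y ≤ c + 2 ^ E by
      have hd : ∀ k, k ≤ a + g → (2 ^ k ∣ y % 2 ^ (a + g + (m + 1)) ↔ 2 ^ k ∣ y) := fun k hk =>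
        Nat.dvd_mod_iff (pow_dvd_pow 2 (by omega))
      have := main (y % 2 ^ (a + g + (m + 1))) (Nat.mod_lt _ (by positivity)) r
        (((Nat.mod_modEq _ _).of_dvd (pow_dvd_pow 2 (by omega))).trans hy) hr0 hr
        ((hd _ (by omega)).mpr hcy) (by rwa [hd _ (by omega)])
      rw [lvOrd_congr (Nat.mod_modEq _ _)] at this
      omega
    have Hc : LvScale c (2 ^ E + 1) :=
      (lvScale_of_dvd c (E + 1) hEc).mono (by have : 0 < 2 ^ E := by positivity
                                              omega)
    clear hcl hcy hr hr0 hy r y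
    refine residue_induction (fun r _ _ _ _ h => absurd (dvd_zero _) h) ?_
    intro y hy0 hylt ih r hy hr0 hr hcy hcl
    have hyr := hmodr y r hy
    obtain ⟨u, rfl⟩ := hcy
    have hu : ¬ 2 ^ 2 ^ E ∣ u := by
      rwa [pow_add, Nat.mul_dvd_mul_iff_left (by positivity)] at hcl
    have hscale := Hc.mono (Nat.le_succ (2 ^ E))
    -- if the supply of `q` fails, the row of `y` is trivial up to level `c + 2 ^ E`, and the
    -- remaining `a' - 2 ^ E` and `m + 1` levels at which its period may double are few enough
    rcases Nat.eq_zero_or_pos (lvOrd (2 ^ E) u) with hd | hd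
    · have h1 := lvOrd_add_le (a + g) (m + 1) (2 ^ c * u)
      rw [lvOrd_congr hy, lvOrd_ones_top a g hr, ← lvOrd_congr hyr] at h1
      have h2 := lvOrd_add_le (c + 2 ^ E) (a' - 2 ^ E) (2 ^ c * u)
      have h3 := hscale.lvOrd_mul_le hd.le
      rw [show c + 2 ^ E + (a' - 2 ^ E) = a by omega] at h2
      omega
    · obtain ⟨q, i, h1, h2, h3⟩ := lvSupply_two_pow E _ hd (lvOrd_lt hu)
      have hz : lv (c + 2 ^ E) (2 ^ c * u) (2 ^ c * q) ≠ 0 := by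
        rw [hscale.mul]
        have := mt lv_eq_zero_iff.mp h2
        positivity
      have hza : lv a r (2 ^ c * q) ≠ 0 := by
        intro h
        rw [← lv_congr_left hyr] at h
        apply hz
        rw [← lv_mod (by omega : c + 2 ^ E ≤ a), h, Nat.zero_mod]
      refine lvOrd_le_of_lv (i := c + i) (q := 2 ^ c * q) (hscale.lvOrd_mul_le h1) ?_ ?_
      · rw [add_assoc, pow_add, Hc.mul]
        positivity
      · refine ih _ (lv_lt _ _ _) (lv_gt' hy0 hylt _) (lv a r (2 ^ c * q)) ?_
          (Nat.pos_of_ne_zero hza) (lv_lt _ _ _) ?_ ?_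
        · refine (lv_modEq (by omega) _ _).trans ?_
          rw [lv_congr_left hy, lv_ones_top a g hr, if_neg hza]
        · rw [Nat.dvd_iff_mod_eq_zero, lv_mod (by omega),
            lv_congr_left (x' := 0) (by simp [Nat.ModEq]), lv_zero_left]
          simp
        · rwa [Nat.dvd_iff_mod_eq_zero, lv_mod (by omega)]

theorem lvOrd_le_of_class {s m g a y r : ℕ} (hm : m + 1 ≤ 2 ^ (s + 1)) (ha : 2 ^ (s + 1) ∣ a)
    (hy : y ≡ 2 ^ a * (2 ^ g - 1) + r [MOD 2 ^ (a + g)]) (h0 : 0 < r) (hr : r < 2 ^ a) :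
    lvOrd (a + g + (m + 1)) y ≤ a :=
  lvOrd_le_of_class_aux hm a 0 a (by simp) Nat.lt_two_pow_self (dvd_zero _) ha y r hy h0 hr
    (one_dvd _)

/-- A row is strictly increasing until it reaches `0`. -/
theorem lv_add_le_lv {n x k d : ℕ} (h0 : 0 < k) (h : k + d < 2 ^ lvOrd n x) :
    lv n x k + d ≤ lv n x (k + d) := by
  induction d with
  | zero => simp
  | succ d ih =>
    have hne : ∀ i, 0 < i → i < 2 ^ lvOrd n x → lv n x i ≠ 0 := fun i hi hi' hz =>
      absurd (Nat.le_of_dvd hi (lv_eq_zero_iff.mp hz)) (by omega)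
    have h1 := ih (by omega)
    have h2 := hne (k + d + 1) (by omega) (by omega)
    have h3 := hne k h0 (by omega)
    rw [lv_succ] at h2
    have h4 := lv_gt (lv_lt _ _ _) h2 (Or.inl (by omega))
    rw [← lv_succ] at h4
    rw [← add_assoc k d 1]
    omega

/-- The row of a multiple of `2 ^ h` begins with `2 ^ h` consecutive values: it is strictly
increasing, and its value at `2 ^ h` leaves no room for gaps. -/
theorem LvScale.lv_eq_add {h m : ℕ} (H : LvScale h m) (u : ℕ) {k : ℕ} (h0 : 0 < k)
    (hk : k ≤ 2 ^ h) : lv (h + m) (2 ^ h * u) k = (2 ^ h * u + k) % 2 ^ (h + m) := by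
  have hred : 2 ^ h * (u % 2 ^ m) ≡ 2 ^ h * u [MOD 2 ^ (h + m)] := by
    rw [pow_add]
    exact (Nat.mod_modEq u _).mul_left' _
  rw [← lv_congr_left hred, ← (hred.add_right k : _ % _ = _)]
  have hu := Nat.mod_lt u (by positivity : 2 ^ m > 0)
  generalize u % 2 ^ m = u at hu
  have hlast : 2 ^ h * (u + 1) ≤ 2 ^ (h + m) := by
    rw [pow_add]
    exact Nat.mul_le_mul_left _ hu
  have hpos : 0 < 2 ^ h := by positivity
  rw [mul_add, mul_one] at hlast
  rcases Nat.eq_zero_or_pos u with rfl | hu0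
  · rw [mul_zero, lv_zero_left, zero_add]
  have hX : 0 < 2 ^ h * u := by positivity
  rcases hlast.eq_or_lt with hlast | hlast
  · have hu1 : u = 2 ^ m - 1 := by
      have := two_pow_mul_pred_add h m
      rw [← this] at hlast
      exact Nat.eq_of_mul_eq_mul_left hpos (by omega)
    have := lv_ones_top h m (r := 0) hpos k
    rw [← hu1, add_zero, lv_zero_left] at this
    rw [this, ← hlast]
    rcases hk.eq_or_lt with rfl | hk
    · simp
    · rw [Nat.mod_eq_of_lt hk, if_neg h0.ne', Nat.mod_eq_of_lt (by omega)]
  · have hend : lv (h + m) (2 ^ h * u) (2 ^ h) = 2 ^ h * u + 2 ^ h := by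
      rw [H, mul_add, mul_one, Nat.mod_eq_of_lt hlast]
    have hord : 2 ^ h < 2 ^ lvOrd (h + m) (2 ^ h * u) := by
      rw [Nat.pow_lt_pow_iff_right (by norm_num)]
      by_contra hcon
      rw [not_lt, lvOrd_le_iff, hend] at hcon
      omega
    have h1 := lv_add_le_lv (n := h + m) (x := 2 ^ h * u) (k := 1) (d := k - 1) one_pos (by omega)
    have h2 := lv_add_le_lv (n := h + m) (x := 2 ^ h * u) (k := k) (d := 2 ^ h - k) h0 (by omega)
    rw [Nat.add_sub_cancel' hk, hend] at h2
    rw [lv_one, Nat.add_sub_cancel' h0, Nat.mod_eq_of_lt (by omega)] at h1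
    rw [Nat.mod_eq_of_lt (by omega)]
    omega

/-- If `2 ^ h`-scaling holds and the elements of the class of `x = 2 ^ a * (2 ^ g - 1)` have
period at most `2 ^ a`, then the row of `x` is obtained by spreading the digits of the argument. -/
theorem lv_spread {a g m : ℕ} (H : LvScale (a + g) m)
    (hc : ∀ y r, y ≡ 2 ^ a * (2 ^ g - 1) + r [MOD 2 ^ (a + g)] → 0 < r → r < 2 ^ a →
      lvOrd (a + g + m) y ≤ a) (u : ℕ) :
    lv (a + g + m) (2 ^ a * (2 ^ g - 1)) (2 ^ a * u) = 2 ^ (a + g) * u % 2 ^ (a + g + m) ∧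
    ∀ r, 0 < r → r < 2 ^ a → lv (a + g + m) (2 ^ a * (2 ^ g - 1)) (2 ^ a * u + r) =
      (2 ^ (a + g) * u + 2 ^ a * (2 ^ g - 1) + r) % 2 ^ (a + g + m) := by
  have hx : 2 ^ a * (2 ^ g - 1) + 2 ^ a = 2 ^ (a + g) :=
    two_pow_mul_pred_add a g
  set x := 2 ^ a * (2 ^ g - 1) with hxdef
  have hxa : 2 ^ a ∣ x := dvd_mul_right _ _
  have hapos : 0 < 2 ^ a := by positivity
  have hstep : ∀ u, lv (a + g + m) x (2 ^ a * u) = 2 ^ (a + g) * u % 2 ^ (a + g + m) →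
      ∀ r, r < 2 ^ a → lv (a + g + m) x (2 ^ a * u + r + 1) =
        (2 ^ (a + g) * u + x + r + 1) % 2 ^ (a + g + m) := by
    intro u hu r
    induction r with
    | zero =>
      intro _
      rw [lv_succ, add_zero, hu, lv_congr_left (Nat.mod_modEq _ _), H.lv_eq_add _ (by omega) (by omega)]
      ring_nf
    | succ r ih =>
      intro hr
      have hord : lvOrd (a + g + m) (2 ^ (a + g) * u + x + (r + 1)) ≤ a := by
        refine hc _ (r + 1) ?_ (by omega) hr
        rw [add_assoc]
        simp [Nat.ModEq]
      have h1 : x + 1 ≡ 1 [MOD 2 ^ lvOrd (a + g + m) (2 ^ (a + g) * u + x + (r + 1))] := by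
        simpa using ((Nat.modEq_zero_iff_dvd).mpr ((pow_dvd_pow 2 hord).trans hxa)).add_right 1
      rw [lv_succ, ← add_assoc (2 ^ a * u), ih (by omega), lv_congr_left (Nat.mod_modEq _ _),
        add_assoc (2 ^ (a + g) * u + x), lv_congr_right_ord h1, lv_one]
  have hmain : lv (a + g + m) x (2 ^ a * u) = 2 ^ (a + g) * u % 2 ^ (a + g + m) := by
    induction u with
    | zero => simp [lv_zero_right]
    | succ u ih =>
      have := hstep u ih (2 ^ a - 1) (by omega)
      rw [show 2 ^ a * u + (2 ^ a - 1) + 1 = 2 ^ a * (u + 1) by rw [mul_add]; omega,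
        show 2 ^ (a + g) * u + x + (2 ^ a - 1) + 1 = 2 ^ (a + g) * (u + 1) by
          rw [mul_add, ← hx]; omega] at this
      exact this
  refine ⟨hmain, fun r h0 hr => ?_⟩
  have := hstep u hmain (r - 1) (by omega)
  rw [show 2 ^ a * u + (r - 1) + 1 = 2 ^ a * u + r by omega,
    show 2 ^ (a + g) * u + x + (r - 1) + 1 = 2 ^ (a + g) * u + x + r by omega] at this
  exact this

/-- If the period of the row of `x` doubles from level `n` to level `n + 1`, then the second half
of the new row is the first half shifted by `2 ^ n`. -/
theorem lv_of_lvOrd_succ {n x z q f : ℕ} (hz : lvOrd n x = z) (hz1 : lvOrd (n + 1) x = z + 1)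
    (hq : q < 2 ^ z) (hf : f < 2 ^ n) (h1 : lv n x (q + 1) = (f + 1) % 2 ^ n) :
    lv (n + 1) x (q + 1) = f + 1 ∧
      lv (n + 1) x (2 ^ z + (q + 1)) = (2 ^ n + (f + 1)) % 2 ^ (n + 1) := by
  have hpow : 2 ^ (n + 1) = 2 ^ n + 2 ^ n := by ring
  have hzp : 2 ^ (z + 1) = 2 ^ z + 2 ^ z := by ring
  have hpos : 0 < 2 ^ n := by positivity
  have hzpos : 0 < 2 ^ z := by positivity
  have hmod := fun y => lv_mod (Nat.le_add_right n 1) x y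
  have hlt := fun y => lv_lt (n + 1) x y
  have hne : ∀ i, 0 < i → i < 2 ^ (z + 1) → lv (n + 1) x i ≠ 0 := fun i hi hi' h => by
    rw [lv_eq_zero_iff, hz1] at h
    exact absurd (Nat.le_of_dvd hi h) (by omega)
  have hmid : lv (n + 1) x (2 ^ z) = 2 ^ n := by
    have h2 := hmod (2 ^ z)
    rw [← hz, lv_two_pow_lvOrd, hz] at h2
    have h3 := hne (2 ^ z) hzpos (by omega)
    have h4 := hlt (2 ^ z)
    rcases Nat.lt_or_ge (lv (n + 1) x (2 ^ z)) (2 ^ n) with h | h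
    · rw [Nat.mod_eq_of_lt h] at h2; omega
    · rw [Nat.mod_eq_sub_mod h, Nat.mod_eq_of_lt (by omega)] at h2; omega
  have hfull : (f + 1) % 2 ^ n = 0 → f + 1 = 2 ^ n := fun h => by
    have := Nat.le_of_dvd (by omega) (Nat.dvd_of_mod_eq_zero h)
    omega
  constructor
  · have h5 := lv_add_le_lv (n := n + 1) (x := x) (k := q + 1)
      (d := 2 ^ z - (q + 1)) (by omega) (by rw [hz1]; omega)
    rw [Nat.add_sub_cancel' (by omega), hmid] at h5
    have h6 := hne (q + 1) (by omega) (by omega)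
    have hres := hmod (q + 1)
    rw [h1] at hres
    rcases (show lv (n + 1) x (q + 1) ≤ 2 ^ n by omega).eq_or_lt with h | h
    · rw [h, Nat.mod_self] at hres
      rw [h, hfull hres.symm]
    · rw [Nat.mod_eq_of_lt h] at hres
      rcases (show f + 1 ≤ 2 ^ n from hf).eq_or_lt with h' | h'
      · rw [h', Nat.mod_self] at hres; omega
      · rwa [Nat.mod_eq_of_lt h'] at hres
  · have hres : lv (n + 1) x (2 ^ z + (q + 1)) % 2 ^ n = (f + 1) % 2 ^ n := by
      rw [hmod, lv_add_of_eq_zero (by rw [← hz, lv_two_pow_lvOrd]), h1]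
    rcases (show q + 1 ≤ 2 ^ z from hq).eq_or_lt with h | h
    · rw [h, ← hz, lv_two_pow_lvOrd] at h1
      rw [h, ← hzp, ← hz1, lv_two_pow_lvOrd, hfull h1.symm, hpow, Nat.mod_self]
    · have h5 := lv_add_le_lv (n := n + 1) (x := x) (k := 2 ^ z) (d := q + 1) hzpos
        (by rw [hz1]; omega)
      have h6 := hlt (2 ^ z + (q + 1))
      rw [hmid] at h5
      rw [Nat.mod_eq_sub_mod (by omega), Nat.mod_eq_of_lt (by omega)] at hres
      rcases (show f + 1 ≤ 2 ^ n from hf).eq_or_lt with h' | h'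
      · rw [h', Nat.mod_self] at hres; omega
      · rw [Nat.mod_eq_of_lt h'] at hres
        rw [Nat.mod_eq_of_lt (by omega)]
        omega

/-! ### Masks -/

/-- The natural number whose binary digits, most significant first, are the complements of the
entries of `w` (`true` being the digit `1`).  If `w` is the binary expansion of `p - 1` with `n`
digits, this is `2 ^ n - p`. -/
def maskCompl : List Bool → ℕ
  | [] => 0
  | true :: w => maskCompl w
  | false :: w => 2 ^ w.length + maskCompl w

theorem maskCompl_lt (w : List Bool) : maskCompl w < 2 ^ w.length := by
  induction w with
  | nil => simp [maskCompl]
  | cons b w ih => cases b <;> simp only [maskCompl, List.length_cons, pow_succ] <;> omega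

theorem maskCompl_append (v w : List Bool) :
    maskCompl (v ++ w) = 2 ^ w.length * maskCompl v + maskCompl w := by
  induction v with
  | nil => simp [maskCompl]
  | cons b v ih =>
    cases b
    · simp only [List.cons_append, maskCompl, ih, List.length_append, pow_add]
      ring
    · simp only [List.cons_append, maskCompl, ih]

theorem maskCompl_replicate_true (k : ℕ) : maskCompl (List.replicate k true) = 0 := by
  induction k with
  | zero => rfl
  | succ k ih => simpa [List.replicate_succ, maskCompl] using ih

theorem maskCompl_replicate_false (k : ℕ) : maskCompl (List.replicate k false) = 2 ^ k - 1 := by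
  induction k with
  | zero => rfl
  | succ k ih =>
    have : 0 < 2 ^ k := by positivity
    simp only [List.replicate_succ, maskCompl, ih, List.length_replicate, pow_succ]
    omega

/-- The exponent of the period of the row described by the mask `w`. -/
noncomputable def maskOrd (w : List Bool) : ℕ := lvOrd w.length (maskCompl w)

theorem maskOrd_cons_false (w : List Bool) : maskOrd (false :: w) = maskOrd w := by
  have := lvOrd_top w.length (maskCompl w)
  rwa [Nat.mod_eq_of_lt (maskCompl_lt w)] at this

theorem maskOrd_cons_true_le (w : List Bool) : maskOrd (true :: w) ≤ maskOrd w + 1 :=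
  lvOrd_succ_le _ _

theorem maskOrd_le (w : List Bool) : maskOrd w ≤ w.count true := by
  induction w with
  | nil => exact lvOrd_le _ _
  | cons b w ih =>
    cases b
    · simpa [maskOrd_cons_false] using ih
    · have := maskOrd_cons_true_le w
      simp only [List.count_cons_self]
      omega

/-- A mask is maximal if the period of its row is the largest one allowed by the number of its
ones. -/
def MaskMax (w : List Bool) : Prop := maskOrd w = w.count true

theorem MaskMax.tail {b : Bool} {w : List Bool} (h : MaskMax (b :: w)) : MaskMax w := by
  unfold MaskMax at *
  cases b
  · simpa [maskOrd_cons_false] using h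
  · have h1 := maskOrd_cons_true_le w
    have h2 := maskOrd_le w
    simp only [List.count_cons_self] at h
    omega

/-- `maskFill w v` puts the entries of `v` at the places of the ones of `w`, leaving the zeros of
`w`.  It is meaningful when the length of `v` is the number of ones of `w`. -/
def maskFill : List Bool → List Bool → List Bool
  | [], _ => []
  | false :: w, v => false :: maskFill w v
  | true :: w, c :: v => c :: maskFill w v
  | true :: _, [] => []

theorem length_maskFill {w v : List Bool} (h : v.length = w.count true) :
    (maskFill w v).length = w.length := by
  induction w generalizing v with
  | nil => rfl
  | cons b w ih =>
    cases b
    · simp only [maskFill, List.length_cons]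
      rw [ih (by simpa using h)]
    · cases v with
      | nil => simp at h
      | cons c v =>
        simp only [maskFill, List.length_cons]
        rw [ih (by simpa using h)]

theorem count_maskFill {w v : List Bool} (h : v.length = w.count true) :
    (maskFill w v).count true = v.count true := by
  induction w generalizing v with
  | nil =>
    have : v = [] := List.length_eq_zero_iff.mp (by simpa using h)
    simp [this, maskFill]
  | cons b w ih =>
    cases b
    · simpa [maskFill] using ih (by simpa using h)
    · cases v with
      | nil => simp at h
      | cons c v =>
        simp only [maskFill, List.count_cons]
        rw [ih (by simpa using h)]

theorem maskFill_append {v v' w w' : List Bool} (h : v.length = w.count true) :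
    maskFill (w ++ w') (v ++ v') = maskFill w v ++ maskFill w' v' := by
  induction w generalizing v with
  | nil =>
    have : v = [] := List.length_eq_zero_iff.mp (by simpa using h)
    simp [this, maskFill]
  | cons b w ih =>
    cases b
    · simpa [maskFill] using ih (by simpa using h)
    · cases v with
      | nil => simp at h
      | cons c v => simpa [maskFill] using ih (by simpa using h)

theorem maskFill_replicate_true {k : ℕ} {v : List Bool} (h : v.length = k) :
    maskFill (List.replicate k true) v = v := by
  induction k generalizing v with
  | zero => simp [List.length_eq_zero_iff.mp h, maskFill]
  | succ k ih =>
    cases v with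
    | nil => simp at h
    | cons c v => simp [List.replicate_succ, maskFill, ih (v := v) (by simpa using h)]

theorem maskFill_replicate_false (k : ℕ) (v : List Bool) :
    maskFill (List.replicate k false) v = List.replicate k false := by
  induction k with
  | zero => simp [maskFill]
  | succ k ih => simp [List.replicate_succ, maskFill, ih]

theorem maskFill_ones (w : List Bool) :
    maskFill w (List.replicate (w.count true) true) = w := by
  induction w with
  | nil => rfl
  | cons b w ih => cases b <;> simp [maskFill, List.replicate_succ, ih]

theorem maskFill_zeros (w : List Bool) :
    maskFill w (List.replicate (w.count true) false) = List.replicate w.length false := by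
  induction w with
  | nil => rfl
  | cons b w ih => cases b <;> simp [maskFill, List.replicate_succ, ih]

/-- The row of a maximal mask `w` deposits the digits of its argument at the ones of `w`. -/
theorem MaskMax.lv_eq {w : List Bool} (hw : MaskMax w) {v : List Bool}
    (hv : v.length = w.count true) :
    lv w.length (maskCompl w) (maskCompl v + 1) =
      (maskCompl (maskFill w v) + 1) % 2 ^ w.length := by
  induction w generalizing v with
  | nil => simp [lv, Nat.mod_one]
  | cons b w ih =>
    have hxlt := maskCompl_lt w
    have hpow : 2 ^ (w.length + 1) = 2 ^ w.length + 2 ^ w.length := by ring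
    cases b
    · rw [List.count_cons_of_ne (by decide)] at hv
      have h1 := ih hw.tail hv
      have hf := maskCompl_lt (maskFill w v)
      rw [length_maskFill hv] at hf
      have h2 := lv_top w.length (maskCompl w) (maskCompl v + 1)
      rw [Nat.mod_eq_of_lt hxlt, h1] at h2
      simp only [maskFill, maskCompl, List.length_cons, length_maskFill hv]
      rw [h2, hpow]
      rcases (show maskCompl (maskFill w v) + 1 ≤ _ from hf).eq_or_lt with h | h
      · rw [add_assoc, h]; simp
      · rw [Nat.mod_eq_of_lt h, if_neg (by omega), Nat.mod_eq_of_lt (by omega), add_assoc]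
    · cases v with
      | nil => simp at hv
      | cons c v =>
        have hv' : v.length = w.count true := by simpa using hv
        have hlen := length_maskFill hv'
        have hf := maskCompl_lt (maskFill w v)
        have hvlt := maskCompl_lt v
        rw [hlen] at hf
        rw [hv'] at hvlt
        have hz1 : lvOrd (w.length + 1) (maskCompl w) = w.count true + 1 := by
          have : lvOrd (w.length + 1) (maskCompl w) = (true :: w).count true := hw
          simpa using this
        obtain ⟨h1, h2⟩ := lv_of_lvOrd_succ hw.tail hz1 hvlt hf (ih hw.tail hv')
        cases c
        · simp only [maskFill, maskCompl, hlen, hv', List.length_cons]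
          rw [add_assoc, h2, add_assoc]
        · simp only [maskFill, maskCompl, List.length_cons]
          rw [h1, Nat.mod_eq_of_lt (by omega)]

/-- Submasks of a maximal mask: the period is that of the submask seen inside the ones of the
maximal mask. -/
theorem MaskMax.maskOrd_fill {w : List Bool} (hw : MaskMax w) {v : List Bool}
    (hv : v.length = w.count true) : maskOrd (maskFill w v) = maskOrd v := by
  unfold maskOrd
  rw [length_maskFill hv]
  apply lvOrd_eq_of
  intro r
  have h : maskCompl (maskFill w v) + 1 ≡
      lv w.length (maskCompl w) (maskCompl v + 1) [MOD 2 ^ w.length] := by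
    rw [hw.lv_eq hv]
    exact (Nat.mod_modEq _ _).symm
  have hord : lvOrd w.length (maskCompl w) = v.length := by rw [hv]; exact hw
  rw [lv_comp h, lv_eq_zero_iff, hord, Nat.dvd_iff_mod_eq_zero,
    lv_mod (by rw [hv]; exact List.count_le_length)]

theorem MaskMax.fill_iff {w : List Bool} (hw : MaskMax w) {v : List Bool}
    (hv : v.length = w.count true) : MaskMax (maskFill w v) ↔ MaskMax v := by
  unfold MaskMax
  rw [hw.maskOrd_fill hv, count_maskFill hv]

/-! ### Basic maximal masks -/

theorem maskMax_replicate_true (k : ℕ) : MaskMax (List.replicate k true) := by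
  unfold MaskMax maskOrd
  rw [maskCompl_replicate_true, lvOrd_zero]
  simp

theorem maskOrd_ones_zeros (k h : ℕ) :
    maskOrd (List.replicate k true ++ List.replicate h false) = lvOrd (h + k) (2 ^ h - 1) := by
  unfold maskOrd
  rw [maskCompl_append, maskCompl_replicate_true, maskCompl_replicate_false]
  simp [add_comm]

theorem LvScale.maskMax {h m : ℕ} (H : LvScale h m) :
    MaskMax (List.replicate m true ++ List.replicate h false) := by
  have hpos : 0 < 2 ^ h := by positivity
  unfold MaskMax
  rw [maskOrd_ones_zeros, H.lvOrd_pred (j := 0) (by positivity) (by omega), lvOrd_zero]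
  simp [List.count_replicate]

/-- The mask `1 1^m 0^g 1^a` describes the row of `2 ^ a * (2 ^ g - 1)`, computed by
`lv_spread`. -/
theorem maskMax_of_class {a g m : ℕ} (H : LvScale (a + g) (m + 1))
    (hc : ∀ y r, y ≡ 2 ^ a * (2 ^ g - 1) + r [MOD 2 ^ (a + g)] → 0 < r → r < 2 ^ a →
      lvOrd (a + g + (m + 1)) y ≤ a) :
    MaskMax (true :: (List.replicate m true ++ List.replicate g false ++
      List.replicate a true)) := by
  have hx : maskCompl (true :: (List.replicate m true ++ List.replicate g false ++
      List.replicate a true)) = 2 ^ a * (2 ^ g - 1) := by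
    simp [maskCompl, maskCompl_append, maskCompl_replicate_true, maskCompl_replicate_false]
  unfold MaskMax maskOrd
  rw [hx]
  have e1 : (true :: (List.replicate m true ++ List.replicate g false ++
      List.replicate a true)).length = a + g + (m + 1) := by simp; omega
  have e2 : (true :: (List.replicate m true ++ List.replicate g false ++
      List.replicate a true)).count true = a + m + 1 := by
    simp [List.count_replicate]; omega
  rw [e1, e2]
  apply le_antisymm
  · rw [lvOrd_le_iff, add_assoc a m 1, pow_add, (lv_spread H hc _).1, ← pow_add, Nat.mod_self]
  · by_contra hcon
    have h1 : lvOrd (a + g + (m + 1)) (2 ^ a * (2 ^ g - 1)) ≤ a + m := by omega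
    rw [lvOrd_le_iff, pow_add, (lv_spread H hc _).1, ← pow_add,
      Nat.mod_eq_of_lt (Nat.pow_lt_pow_right (by norm_num) (by omega))] at h1
    exact absurd h1 (by positivity)

theorem maskMax_ones_zeros_ones {s m g a : ℕ} (hm : m + 1 ≤ 2 * 2 ^ s) (hg : 2 ^ s ∣ g)
    (ha : 2 ^ (s + 1) ∣ a) :
    MaskMax (true :: (List.replicate m true ++ List.replicate g false ++
      List.replicate a true)) := by
  refine maskMax_of_class ((lvScale_of_dvd (a + g) s
    (Nat.dvd_add ((pow_dvd_pow 2 (by omega)).trans ha) hg)).mono hm) fun y r hy h0 hr => ?_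
  exact lvOrd_le_of_class (by rw [pow_succ]; omega) ha hy h0 hr

theorem maskMax_one_zero_ones (a : ℕ) :
    MaskMax (true :: false :: List.replicate a true) := by
  refine maskMax_of_class (m := 0) (g := 1) (lvScale_one _) fun y r hy h0 hr => ?_
  have h1 := lvOrd_add_le (a + 1) (0 + 1) y
  rw [lvOrd_congr hy, lvOrd_ones_top a 1 hr] at h1
  have h2 : lvOrd a r < a := lvOrd_lt fun h => absurd (Nat.le_of_dvd h0 h) (by omega)
  omega

/-! ### Words made of aligned blocks -/

/-- The word `1^{2^{a_1}} 0^{b_1 2^{a_1}} 1^{2^{a_2}} 0^{b_2 2^{a_2}} ⋯` of a list of pairs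
`(a_i, b_i)`. -/
def blockWord (T : List (ℕ × ℕ)) : List Bool :=
  T.flatMap fun t => List.replicate (2 ^ t.1) true ++ List.replicate (t.2 * 2 ^ t.1) false

theorem blockWord_nil : blockWord [] = [] := rfl

theorem blockWord_cons (t : ℕ × ℕ) (T : List (ℕ × ℕ)) : blockWord (t :: T) =
    List.replicate (2 ^ t.1) true ++ List.replicate (t.2 * 2 ^ t.1) false ++ blockWord T := rfl

theorem blockWord_append (T T' : List (ℕ × ℕ)) :
    blockWord (T ++ T') = blockWord T ++ blockWord T' := List.flatMap_append

theorem count_blockWord (T : List (ℕ × ℕ)) :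
    (blockWord T).count true = (T.map fun t => 2 ^ t.1).sum := by
  induction T with
  | nil => rfl
  | cons t T ih => simp [blockWord_cons, List.count_replicate, ih]

theorem length_blockWord (T : List (ℕ × ℕ)) :
    (blockWord T).length = (T.map fun t => (t.2 + 1) * 2 ^ t.1).sum := by
  induction T with
  | nil => rfl
  | cons t T ih => simp [blockWord_cons, ih]; ring

theorem dvd_count_blockWord {T : List (ℕ × ℕ)} {s : ℕ} (h : ∀ t ∈ T, s ≤ t.1) :
    2 ^ s ∣ (blockWord T).count true := by
  rw [count_blockWord]
  refine List.dvd_sum fun x hx => ?_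
  obtain ⟨t, ht, rfl⟩ := List.mem_map.mp hx
  exact pow_dvd_pow 2 (h t ht)

theorem dvd_length_blockWord {T : List (ℕ × ℕ)} {s : ℕ} (h : ∀ t ∈ T, s ≤ t.1) :
    2 ^ s ∣ (blockWord T).length := by
  rw [length_blockWord]
  refine List.dvd_sum fun x hx => ?_
  obtain ⟨t, ht, rfl⟩ := List.mem_map.mp hx
  exact (pow_dvd_pow 2 (h t ht)).mul_left _

theorem count_blockWord_lt {T : List (ℕ × ℕ)} (hT : T.Pairwise fun t t' => t.1 < t'.1) {s : ℕ}
    (h : ∀ t ∈ T, t.1 < s) : (blockWord T).count true < 2 ^ s := by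
  induction T using List.reverseRecOn generalizing s with
  | nil => simp [blockWord_nil]
  | append_singleton T t ih =>
    rw [List.pairwise_append] at hT
    have h1 := ih hT.1 fun t' ht' => hT.2.2 t' ht' t (by simp)
    have h2 : 2 ^ (t.1 + 1) ≤ 2 ^ s := Nat.pow_le_pow_right (by norm_num) (h t (by simp))
    rw [blockWord_append, List.count_append, count_blockWord [t]]
    simp only [List.map_cons, List.map_nil, List.sum_cons, List.sum_nil]
    rw [pow_succ] at h2
    omega

/-- Words made of blocks of increasing sizes give maximal masks.  The last block is removed by
viewing the mask as a submask of the one where that block and everything below it is filled up. -/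
theorem maskMax_blockWord_append {T : List (ℕ × ℕ)} (hT : T.Pairwise fun t t' => t.1 < t'.1)
    {a : ℕ} (ha : ∀ t ∈ T, 2 ^ (t.1 + 1) ∣ a) :
    MaskMax (true :: (blockWord T ++ List.replicate a true)) := by
  induction T using List.reverseRecOn generalizing a with
  | nil =>
    have := maskMax_replicate_true (a + 1)
    rwa [List.replicate_succ] at this
  | append_singleton T t ih =>
    obtain ⟨s, b⟩ := t
    rw [List.pairwise_append] at hT
    have hlt : ∀ t ∈ T, t.1 < s := fun t ht => hT.2.2 t ht (s, b) (by simp)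
    have has : 2 ^ (s + 1) ∣ a := ha (s, b) (by simp)
    have hfull := ih hT.1 (a := 2 ^ s + (b * 2 ^ s + a)) fun t ht => by
      have h1 : 2 ^ (t.1 + 1) ∣ 2 ^ s := pow_dvd_pow 2 (hlt t ht)
      have h2 : 2 ^ (t.1 + 1) ∣ a := (pow_dvd_pow 2 (by have := hlt t ht; omega)).trans has
      exact Nat.dvd_add h1 (Nat.dvd_add (h1.mul_left b) h2)
    set c := (blockWord T).count true with hc
    have hclt : c < 2 ^ s := count_blockWord_lt hT.1 hlt
    have hsub : MaskMax (true :: (List.replicate (c + 2 ^ s) true ++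
        List.replicate (b * 2 ^ s) false ++ List.replicate a true)) :=
      maskMax_ones_zeros_ones (s := s) (by omega) (Dvd.intro_left b rfl) has
    have hlen : (true :: (List.replicate (c + 2 ^ s) true ++
        List.replicate (b * 2 ^ s) false ++ List.replicate a true)).length =
        (true :: (blockWord T ++ List.replicate (2 ^ s + (b * 2 ^ s + a)) true)).count true := by
      simp [← hc]
      omega
    rw [← hfull.fill_iff hlen] at hsub
    convert hsub using 1
    rw [maskFill, List.replicate_add c, List.append_assoc, List.append_assoc,
      maskFill_append (by simp [← hc]), hc, maskFill_ones, maskFill_replicate_true (by simp),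
      blockWord_append, blockWord_cons, blockWord_nil]
    simp

theorem maskMax_blockWord {T : List (ℕ × ℕ)} (hT : T.Pairwise fun t t' => t.1 < t'.1) :
    MaskMax (true :: blockWord T) := by
  simpa using maskMax_blockWord_append hT (a := 0) fun _ _ => dvd_zero _

/-! ### Maximal masks are made of aligned blocks -/

/-- Two blocks of the same size `2 ^ s`, the lower one at an odd multiple of `2 ^ s`. -/
theorem not_maskMax_of_odd {s j c : ℕ} (hj : 2 ^ s ∣ j) (hc : c % 2 = 1) :
    ¬ MaskMax (true :: (List.replicate (2 ^ s) true ++ (List.replicate j false ++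
      (List.replicate (2 ^ s) true ++ List.replicate (2 ^ s * c) false)))) := by
  intro h
  have hpos : 0 < 2 ^ s := by positivity
  have hfull : MaskMax (true :: (List.replicate (2 ^ s) true ++ List.replicate j false ++
      List.replicate (2 ^ s + 2 ^ s * c) true)) := by
    refine maskMax_ones_zeros_ones (s := s) (by omega) hj ?_
    obtain ⟨d, rfl⟩ : ∃ d, c = 2 * d + 1 := ⟨c / 2, by omega⟩
    exact ⟨d + 1, by ring⟩
  have hlen : (List.replicate (2 * 2 ^ s + 1) true ++ List.replicate (2 ^ s * c) false).length =
      (true :: (List.replicate (2 ^ s) true ++ List.replicate j false ++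
        List.replicate (2 ^ s + 2 ^ s * c) true)).count true := by
    simp [List.count_replicate]; ring
  have hv := hfull.fill_iff hlen
  have e : maskFill (true :: (List.replicate (2 ^ s) true ++ List.replicate j false ++
        List.replicate (2 ^ s + 2 ^ s * c) true))
      (List.replicate (2 * 2 ^ s + 1) true ++ List.replicate (2 ^ s * c) false) =
      true :: (List.replicate (2 ^ s) true ++ (List.replicate j false ++
      (List.replicate (2 ^ s) true ++ List.replicate (2 ^ s * c) false))) := by
    rw [List.replicate_succ, two_mul, List.replicate_add (2 ^ s) (2 ^ s), List.cons_append, maskFill,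
      List.append_assoc, List.append_assoc, maskFill_append (by simp),
      maskFill_replicate_true (by simp)]
    congr 2
    have := maskFill_append (v := []) (v' := List.replicate (2 ^ s) true ++
      List.replicate (2 ^ s * c) false) (w := List.replicate j false)
      (w' := List.replicate (2 ^ s + 2 ^ s * c) true) (by simp [List.count_replicate])
    rw [List.nil_append, maskFill_replicate_false, maskFill_replicate_true (by simp)] at this
    exact this
  rw [e] at hv
  have h1 : maskOrd _ = _ := hv.mp h
  rw [maskOrd_ones_zeros] at h1
  have h2 := lvOrd_pred_two_pow_le (s := s) hc
  simp [List.count_replicate] at h1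
  omega

/-- Two blocks of the same size `2 ^ s`, separated by a gap, the lower one at an even multiple of
`2 ^ s`. -/
theorem not_maskMax_of_gap {s j c : ℕ} (hj : 2 ^ s ∣ j) (hj0 : 0 < j) (hc : 2 ^ (s + 1) ∣ c) :
    ¬ MaskMax (true :: (List.replicate (2 ^ s) true ++ (List.replicate j false ++
      (List.replicate (2 ^ s) true ++ List.replicate c false)))) := by
  intro h
  set w := true :: (List.replicate (2 ^ s) true ++ (List.replicate j false ++
      (List.replicate (2 ^ s) true ++ List.replicate c false))) with hw
  obtain ⟨k, hk⟩ : ∃ k, 2 ^ s = k + 1 := ⟨2 ^ s - 1, by have : 0 < 2 ^ s := by positivity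
                                                        omega⟩
  have hcount : w.count true = 2 * 2 ^ s + 1 := by
    simp [hw, List.count_replicate]; ring
  have hlen : w.length = c + (j + 2 ^ s) + (2 ^ s + 1) := by simp [hw]; ring
  -- two consecutive values of the row of `w`, at `2 ^ 2 ^ s - 1` and `2 ^ 2 ^ s`
  have h1 := h.lv_eq (v := true :: (List.replicate (2 ^ s) true ++
    (List.replicate k false ++ [true]))) (by rw [hcount]; simp; omega)
  have h2 := h.lv_eq (v := true :: (List.replicate (2 ^ s) true ++
    List.replicate (2 ^ s) false)) (by rw [hcount]; simp; omega)
  have hgap : ∀ v, maskFill (List.replicate j false ++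
      (List.replicate (2 ^ s) true ++ List.replicate c false)) v =
      List.replicate j false ++ maskFill (List.replicate (2 ^ s) true ++
        List.replicate c false) v := by
    intro v
    have := maskFill_append (v := []) (v' := v) (w := List.replicate j false)
      (w' := List.replicate (2 ^ s) true ++ List.replicate c false)
      (by simp [List.count_replicate])
    rwa [List.nil_append, maskFill_replicate_false] at this
  have hlow : ∀ v : List Bool, v.length = 2 ^ s → maskFill w (true :: (List.replicate (2 ^ s) true
      ++ v)) = true :: (List.replicate (2 ^ s) true ++ (List.replicate j false ++
        (v ++ List.replicate c false))) := by
    intro v hv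
    rw [hw, maskFill, maskFill_append (by simp), maskFill_replicate_true (by simp), hgap]
    congr 3
    have := maskFill_append (v := v) (v' := []) (w := List.replicate (2 ^ s) true)
      (w' := List.replicate c false) (by simpa [List.count_replicate] using hv)
    rwa [List.append_nil, maskFill_replicate_false, maskFill_replicate_true hv] at this
  have hpow : ∀ i, 2 ^ i - 1 + 1 = 2 ^ i := fun i => Nat.sub_add_cancel Nat.one_le_two_pow
  rw [hlow _ (by simp; omega)] at h1
  rw [hlow _ (by simp)] at h2
  have hx : maskCompl w + 1 = 2 ^ c * (2 ^ 2 ^ s * (2 ^ j - 1) + 1) := by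
    simp only [hw, maskCompl, maskCompl_append, maskCompl_replicate_true,
      maskCompl_replicate_false, List.length_append, List.length_replicate, pow_add]
    have := hpow c
    rw [mul_zero, zero_add, mul_zero, zero_add, add_assoc, this]
    ring
  set n := w.length with hn
  have hs0 := hpow (2 ^ s)
  have hc0 := hpow c
  have hj0' := hpow j
  have hk0 := hpow k
  have hval1 : maskCompl (true :: (List.replicate (2 ^ s) true ++ (List.replicate k false ++
      [true]))) + 1 = 2 ^ 2 ^ s - 1 := by
    simp only [maskCompl, maskCompl_append, maskCompl_replicate_true,
      maskCompl_replicate_false, List.length_append, List.length_replicate, List.length_cons,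
      List.length_nil, hk, pow_add, pow_one, pow_zero]
    omega
  have hval2 : maskCompl (true :: (List.replicate (2 ^ s) true ++
      List.replicate (2 ^ s) false)) = 2 ^ 2 ^ s - 1 := by
    simp only [maskCompl, maskCompl_append, maskCompl_replicate_true,
      maskCompl_replicate_false, mul_zero, zero_add]
  have hres1 : maskCompl (true :: (List.replicate (2 ^ s) true ++ (List.replicate j false ++
      ((List.replicate k false ++ [true]) ++ List.replicate c false)))) + 1 =
      2 ^ c * (2 ^ (j + 2 ^ s) - 1) := by
    simp only [maskCompl, maskCompl_append, maskCompl_replicate_true,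
      maskCompl_replicate_false, List.length_append, List.length_replicate, List.length_cons,
      List.length_nil, hk, pow_add, pow_one, mul_zero, zero_add, add_zero]
    generalize 2 ^ c - 1 = C at *
    generalize 2 ^ j - 1 = J at *
    generalize 2 ^ k - 1 = K at *
    rw [← hc0, ← hj0', ← hk0]
    have : (J + 1) * ((K + 1) * 2) - 1 = J * ((K + 1) * 2) + 2 * K + 1 := by
      rw [Nat.sub_eq_iff_eq_add (Nat.succ_le_of_lt (by positivity))]; ring
    rw [this]
    ring
  have hres2 : maskCompl (true :: (List.replicate (2 ^ s) true ++ (List.replicate j false ++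
      (List.replicate (2 ^ s) false ++ List.replicate c false)))) + 1 =
      2 ^ (c + (j + 2 ^ s)) := by
    simp only [maskCompl, maskCompl_append, maskCompl_replicate_true,
      maskCompl_replicate_false, List.length_append, List.length_replicate, pow_add, mul_zero,
      zero_add]
    generalize 2 ^ c - 1 = C at *
    generalize 2 ^ j - 1 = J at *
    generalize 2 ^ 2 ^ s - 1 = K at *
    rw [← hc0, ← hj0', ← hs0]
    ring
  rw [hval1, hres1] at h1
  rw [hval2, hres2, lv_succ, h1, hx, lv_congr_left (Nat.mod_modEq _ _), hlen] at h2
  have hscale : LvScale (c + (j + 2 ^ s)) (2 ^ s + 1) :=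
    (lvScale_of_dvd _ s (Nat.dvd_add ((pow_dvd_pow 2 (by omega)).trans hc)
      (Nat.dvd_add hj dvd_rfl))).mono (by omega)
  rw [(lv_spread hscale (fun y r hy h0 hr =>
    lvOrd_le_of_class (s := s) (by rw [pow_succ]; omega) hc hy h0 hr) _).1,
    pow_add 2 (c + (j + 2 ^ s)), Nat.mul_mod_mul_left] at h2
  nth_rw 2 [← mul_one (2 ^ (c + (j + 2 ^ s)))] at h2
  rw [Nat.mul_mod_mul_left] at h2
  -- the bit of `2 ^ n - p` just above the lower block is `1` because of the gap
  have h3 : 2 ^ 2 ^ s * (2 ^ j - 1) + 1 ≡ 0 + 1 [MOD 2 ^ (2 ^ s + 1)] := by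
    rw [zero_add]
    exact Nat.eq_of_mul_eq_mul_left (by positivity) h2
  have h4 := (Nat.modEq_zero_iff_dvd).mp (Nat.ModEq.add_right_cancel' 1 h3)
  rw [pow_succ, Nat.mul_dvd_mul_iff_left (by positivity)] at h4
  have h5 : 2 ∣ 2 ^ j := dvd_pow_self 2 hj0.ne'
  omega

/-- A submask of the leading part of a maximal mask, whose remainder has an even multiple of
`2 ^ s` ones: cutting off that remainder preserves maximality. -/
theorem MaskMax.cut {s j b : ℕ} {R : List Bool} (hR : 2 ^ (s + 1) ∣ R.count true)
    (h : MaskMax (true :: (List.replicate (2 ^ s) true ++ (List.replicate j false ++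
      (List.replicate (2 ^ s) true ++ (List.replicate b false ++ R)))))) :
    MaskMax (true :: (List.replicate (2 ^ s) true ++ (List.replicate j false ++
      (List.replicate (2 ^ s) true ++ List.replicate (b + R.length) false)))) := by
  have hlen : (true :: (List.replicate (2 ^ s) true ++ (List.replicate (2 ^ s) true ++
      List.replicate (R.count true) false))).length =
      (true :: (List.replicate (2 ^ s) true ++ (List.replicate j false ++
      (List.replicate (2 ^ s) true ++ (List.replicate b false ++ R))))).count true := by
    simp [List.count_replicate]
  have hpos : 0 < 2 ^ s := by positivity
  have hv : MaskMax (true :: (List.replicate (2 ^ s) true ++ (List.replicate (2 ^ s) true ++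
      List.replicate (R.count true) false))) := by
    have := ((lvScale_of_dvd _ (s + 1) hR).mono (by rw [pow_succ]; omega : _ ≤ _)).maskMax
      (m := 2 ^ s + 2 ^ s + 1)
    rwa [List.replicate_succ, List.replicate_add, List.cons_append, List.append_assoc] at this
  rw [← h.fill_iff hlen] at hv
  have hgap : ∀ k (w v : List Bool), maskFill (List.replicate k false ++ w) v =
      List.replicate k false ++ maskFill w v := by
    intro k w v
    have := maskFill_append (v := []) (v' := v) (w := List.replicate k false) (w' := w)
      (by simp [List.count_replicate])
    rwa [List.nil_append, maskFill_replicate_false] at this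
  rw [maskFill, maskFill_append (by simp), maskFill_replicate_true (by simp), hgap,
    maskFill_append (by simp), maskFill_replicate_true (by simp), hgap, maskFill_zeros,
    ← List.replicate_add] at hv
  exact hv

/-- Prepending a block of size `2 ^ s` to a word of larger blocks.  If the next block has the same
size, the two have to merge to an aligned block of size `2 ^ (s + 1)`. -/
theorem exists_blockWord_of_maskMax {T : List (ℕ × ℕ)} :
    ∀ {s j : ℕ}, T.Pairwise (fun t t' => t.1 < t'.1) → (∀ t ∈ T, s ≤ t.1) → 2 ^ s ∣ j →
      MaskMax (true :: (List.replicate (2 ^ s) true ++ (List.replicate j false ++ blockWord T))) →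
      ∃ T' : List (ℕ × ℕ), T'.Pairwise (fun t t' => t.1 < t'.1) ∧
        List.replicate (2 ^ s) true ++ (List.replicate j false ++ blockWord T) = blockWord T' := by
  induction T with
  | nil =>
    intro s j _ _ ⟨d, hd⟩ _
    exact ⟨[(s, d)], by simp, by simp [blockWord_cons, blockWord_nil, hd, mul_comm]⟩
  | cons t T ih =>
    intro s j hT hs hj hM
    obtain ⟨s', b⟩ := t
    rcases (hs (s', b) (by simp)).lt_or_eq with hlt | heq
    · obtain ⟨d, hd⟩ := hj
      refine ⟨(s, d) :: (s', b) :: T, ?_, ?_⟩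
      · refine List.pairwise_cons.mpr ⟨fun t ht => ?_, hT⟩
        rcases List.mem_cons.mp ht with rfl | ht'
        · exact hlt
        · exact hlt.trans ((List.pairwise_cons.mp hT).1 t ht')
      · rw [blockWord_cons (s, d)]
        simp [hd, mul_comm]
    · simp only at heq
      subst heq
      obtain ⟨hT1, hT2⟩ := List.pairwise_cons.mp hT
      have hT3 : ∀ t ∈ T, s + 1 ≤ t.1 := fun t ht => hT1 t ht
      rw [blockWord_cons, List.append_assoc] at hM ⊢
      have hcut := hM.cut (dvd_count_blockWord hT3)
      obtain ⟨d, hd⟩ := dvd_length_blockWord hT3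
      have hb : b % 2 = 0 := by
        by_contra hb
        refine not_maskMax_of_odd hj (c := b + 2 * d) (by omega) ?_
        rwa [hd, show b * 2 ^ s + 2 ^ (s + 1) * d = 2 ^ s * (b + 2 * d) by ring] at hcut
      obtain ⟨e, rfl⟩ : ∃ e, b = 2 * e := ⟨b / 2, by omega⟩
      have hj0 : j = 0 := by
        by_contra hj0
        refine not_maskMax_of_gap hj (Nat.pos_of_ne_zero hj0) (c := 2 * e * 2 ^ s +
          (blockWord T).length) ?_ hcut
        rw [hd]
        exact ⟨e + d, by ring⟩
      subst hj0
      have hmerge : List.replicate (2 ^ s) true ++ (List.replicate 0 false ++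
          (List.replicate (2 ^ s) true ++ (List.replicate (2 * e * 2 ^ s) false ++
            blockWord T))) = List.replicate (2 ^ (s + 1)) true ++
          (List.replicate (2 * e * 2 ^ s) false ++ blockWord T) := by
        rw [pow_succ, mul_two, List.replicate_add]
        simp only [List.replicate_zero, List.nil_append, List.append_assoc]
      simp only at hM ⊢
      rw [hmerge] at hM ⊢
      exact ih hT2 hT3 ⟨e, by ring⟩ hM

theorem exists_blockWord_of_maskMax_cons {W : List Bool} (h : MaskMax (true :: W)) :
    ∃ (j : ℕ) (T : List (ℕ × ℕ)), T.Pairwise (fun t t' => t.1 < t'.1) ∧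
      W = List.replicate j false ++ blockWord T := by
  induction W with
  | nil => exact ⟨0, [], by simp, rfl⟩
  | cons b W ih =>
    cases b
    · -- a leading zero can be removed: the mask is a submask of `1 0 1 ⋯ 1`
      have hlen : (true :: W).length =
          (true :: false :: List.replicate W.length true).count true := by simp
      have hfill := (maskMax_one_zero_ones W.length).fill_iff hlen
      rw [maskFill, maskFill, maskFill_replicate_true rfl] at hfill
      obtain ⟨j, T, hT, hW⟩ := ih (hfill.mp h)
      exact ⟨j + 1, T, hT, by rw [hW, List.replicate_succ, List.cons_append]⟩
    · obtain ⟨j, T, hT, hW⟩ := ih h.tail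
      obtain ⟨T', hT', hW'⟩ := exists_blockWord_of_maskMax (s := 0) (j := j) hT (by simp)
        (by simp) (by simpa [← hW] using h)
      exact ⟨0, T', hT', by simpa [hW] using hW'⟩

/-- Maximal masks beginning with two ones are the words of aligned blocks. -/
theorem exists_blockWord_of_maskMax_cons_cons {W : List Bool} (h : MaskMax (true :: true :: W)) :
    ∃ T : List (ℕ × ℕ), T.Pairwise (fun t t' => t.1 < t'.1) ∧ true :: W = blockWord T := by
  obtain ⟨j, T, hT, hW⟩ := exists_blockWord_of_maskMax_cons h
  cases j with
  | zero => exact ⟨T, hT, by simpa using hW⟩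
  | succ j => simp [List.replicate_succ] at hW

/-! ### Periods in the backwards notation -/

theorem laverStar_eq_ite {n x y : ℕ} (hx0 : 0 < x) (hx : x ≤ 2 ^ n) (hy0 : 0 < y)
    (hy : y ≤ 2 ^ n) : laverStar (2 ^ n) x y = if lv n x y = 0 then 2 ^ n else lv n x y := by
  have hb : 0 < laverStar (2 ^ n) x y ∧ laverStar (2 ^ n) x y ≤ 2 ^ n := by
    rcases hx.lt_or_eq with h | h
    · have := laverStar_bounds _ _ h y
      omega
    · rw [h, laverStar_top]; exact ⟨hy0, hy⟩
  unfold lv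
  rw [lvRep_of_pos_of_le hx0 hx]
  rcases hb.2.lt_or_eq with h | h
  · rw [Nat.mod_eq_of_lt h, if_neg (by omega)]
  · rw [h]; simp

/-- The backwards operation computed in any sufficiently large table. -/
theorem laverBack_eq {k p q : ℕ} (hp0 : 0 < p) (hp : p < 2 ^ k) (hq : q < 2 ^ k) :
    laverBack p q =
      if lv k (2 ^ k - p) (2 ^ k - q) = 0 then 0 else 2 ^ k - lv k (2 ^ k - p) (2 ^ k - q) := by
  have hmax : max p q < 2 ^ k := max_lt hp hq
  induction k, Nat.size_le.mpr hmax using Nat.le_induction with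
  | base =>
    unfold laverBack
    rw [laverStar_eq_ite (by omega) (by omega) (by omega) (by omega)]
    split_ifs <;> simp
  | succ k hk ih =>
    have hmax' := Nat.size_le.mp hk
    have hp' : p < 2 ^ k := (le_max_left p q).trans_lt hmax'
    have hq' : q < 2 ^ k := (le_max_right p q).trans_lt hmax'
    have hpow : 2 ^ (k + 1) = 2 ^ k + 2 ^ k := by ring
    rw [ih hp' hq' hmax']
    have h1 := lv_top k (2 ^ k - p) (2 ^ (k + 1) - q)
    have h2 : 2 ^ (k + 1) - q ≡ 2 ^ k - q [MOD 2 ^ k] := by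
      rw [hpow, Nat.add_sub_assoc hq'.le]
      simp [Nat.ModEq]
    rw [lv_congr_right _ h2, Nat.mod_eq_of_lt (by omega),
      show 2 ^ k + (2 ^ k - p) = 2 ^ (k + 1) - p by omega] at h1
    have h3 := lv_lt k (2 ^ k - p) (2 ^ k - q)
    rw [h1]
    split_ifs with h4 h5 h5
    · rfl
    · exact absurd rfl h5
    · omega
    · omega

theorem lvOrd_two_pow_sub {n k p : ℕ} (hp0 : 0 < p) (hp : p ≤ 2 ^ n) (hk : n ≤ k) :
    lvOrd k (2 ^ k - p) = lvOrd n (2 ^ n - p) := by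
  induction k, hk using Nat.le_induction with
  | base => rfl
  | succ k hk ih =>
    have hpk : p ≤ 2 ^ k := hp.trans (Nat.pow_le_pow_right (by norm_num) hk)
    have := lvOrd_top k (2 ^ k - p)
    rw [Nat.mod_eq_of_lt (by omega), ih] at this
    rw [← this]
    congr 1
    rw [pow_succ]
    omega

theorem laverBack_periodic_iff {n p t : ℕ} (hp0 : 0 < p) (hp : p ≤ 2 ^ n) :
    Function.Periodic (laverBack p) t ↔ 2 ^ lvOrd n (2 ^ n - p) ∣ t := by
  have hlarge : ∀ q, ∃ k, n ≤ k ∧ p < 2 ^ k ∧ q < 2 ^ k := fun q =>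
    ⟨n + p + q, by omega,
      Nat.lt_two_pow_self.trans_le (Nat.pow_le_pow_right (by norm_num) (by omega)),
      Nat.lt_two_pow_self.trans_le (Nat.pow_le_pow_right (by norm_num) (by omega))⟩
  constructor
  · intro h
    obtain ⟨k, hk, hpk, htk⟩ := hlarge t
    have h1 := h 0
    have hlt := lv_lt k (2 ^ k - p) (2 ^ k - t)
    rw [zero_add, laverBack_eq hp0 hpk htk, laverBack_eq hp0 hpk (by positivity), Nat.sub_zero,
      if_pos ((lv_two_pow_and_mod k).1 _)] at h1
    have h2 : lv k (2 ^ k - p) (2 ^ k - t) = 0 := by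
      split_ifs at h1 with h3
      · exact h3
      · omega
    rw [lv_eq_zero_iff, Nat.dvd_sub_iff_right htk.le (pow_dvd_pow 2 (lvOrd_le _ _)),
      lvOrd_two_pow_sub hp0 hp hk] at h2
    exact h2
  · intro h q
    obtain ⟨k, hk, hpk, hqk⟩ := hlarge (q + t)
    have h1 : lv k (2 ^ k - p) (2 ^ k - (q + t)) = lv k (2 ^ k - p) (2 ^ k - q) := by
      refine lv_congr_right_ord ?_
      rw [lvOrd_two_pow_sub hp0 hp hk, show 2 ^ k - q = 2 ^ k - (q + t) + t by omega]
      simpa using (Nat.modEq_zero_iff_dvd.mpr h).symm.add_left (2 ^ k - (q + t))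
    rw [laverBack_eq hp0 hpk hqk, laverBack_eq hp0 hpk (by omega), h1]

theorem laverPeriod_eq {n p : ℕ} (hp0 : 0 < p) (hp : p ≤ 2 ^ n) :
    laverPeriod p = 2 ^ lvOrd n (2 ^ n - p) := by
  unfold laverPeriod
  simp only [laverBack_periodic_iff hp0 hp]
  apply le_antisymm
  · exact Nat.sInf_le ⟨by positivity, dvd_rfl⟩
  · have := Nat.sInf_mem (s := {t | 0 < t ∧ 2 ^ lvOrd n (2 ^ n - p) ∣ t})
      ⟨_, by positivity, dvd_rfl⟩
    exact Nat.le_of_dvd this.1 this.2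

/-! ### Masks and binary expansions -/

/-- The number `p` such that `w` is the binary expansion of `p - 1`. -/
def maskElt (w : List Bool) : ℕ := 2 ^ w.length - maskCompl w

theorem maskElt_pos (w : List Bool) : 0 < maskElt w := Nat.sub_pos_of_lt (maskCompl_lt w)

theorem ofDigits_mask (w : List Bool) :
    Nat.ofDigits 2 (w.map Bool.toNat).reverse + 1 = maskElt w := by
  unfold maskElt
  have h := maskCompl_lt w
  suffices hs : Nat.ofDigits 2 (w.map Bool.toNat).reverse + 1 + maskCompl w = 2 ^ w.length by
    omega
  clear h
  induction w with
  | nil => rfl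
  | cons b w ih =>
    rw [List.map_cons, List.reverse_cons, Nat.ofDigits_append]
    cases b <;> simp [maskCompl, pow_succ] <;> omega

theorem digits_maskElt (w : List Bool) :
    Nat.digits 2 (maskElt (true :: w) - 1) = ((true :: w).map Bool.toNat).reverse := by
  rw [← ofDigits_mask, Nat.add_sub_cancel]
  apply Nat.digits_ofDigits 2 (by norm_num)
  · intro l hl
    rw [List.mem_reverse, List.mem_map] at hl
    obtain ⟨b, -, rfl⟩ := hl
    cases b <;> simp
  · intro h
    simp

theorem count_map_toNat (w : List Bool) : (w.map Bool.toNat).count 1 = w.count true := by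
  induction w with
  | nil => rfl
  | cons b w ih => cases b <;> simp [ih]

theorem map_toNat_injective : Function.Injective (List.map Bool.toNat) :=
  List.map_injective_iff.mpr fun a b h => by cases a <;> cases b <;> simp_all

theorem laverPeriod_maskElt (w : List Bool) : laverPeriod (maskElt w) = 2 ^ maskOrd w := by
  have h := maskCompl_lt w
  have hle : maskElt w ≤ 2 ^ w.length := Nat.sub_le _ _
  rw [laverPeriod_eq (maskElt_pos w) hle, maskOrd]
  congr 2
  unfold maskElt
  omega

theorem isLaverMaximal_maskElt_iff (w : List Bool) :
    IsLaverMaximal (maskElt (true :: w)) ↔ MaskMax (true :: w) := by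
  unfold IsLaverMaximal MaskMax bitCount
  rw [laverPeriod_maskElt, digits_maskElt, List.count_reverse, count_map_toNat]
  simp only [maskElt_pos, true_and]
  exact Nat.pow_right_inj one_lt_two

theorem exists_maskCompl_eq {n x : ℕ} (hx : x < 2 ^ n) :
    ∃ w : List Bool, w.length = n ∧ maskCompl w = x := by
  induction n generalizing x with
  | zero => exact ⟨[], rfl, by simp at hx; simp [maskCompl, hx]⟩
  | succ n ih =>
    have hpow : 2 ^ (n + 1) = 2 ^ n + 2 ^ n := by ring
    rcases Nat.lt_or_ge x (2 ^ n) with h | h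
    · obtain ⟨w, hw, hx⟩ := ih h
      exact ⟨true :: w, by simp [hw], hx⟩
    · obtain ⟨w, hw, hx⟩ := ih (x := x - 2 ^ n) (by omega)
      exact ⟨false :: w, by simp [hw], by simp [maskCompl, hw, hx]; omega⟩

/-- The numbers in `(2 ^ (n - 1) + 2 ^ (n - 2), 2 ^ n]` are those for which the binary expansion
of `p - 1` has length `n` and begins with two ones. -/
theorem mem_Ioc_iff_exists_mask {n p : ℕ} (hn : 2 ≤ n) :
    p ∈ Set.Ioc (2 ^ (n - 1) + 2 ^ (n - 2)) (2 ^ n) ↔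
      ∃ w : List Bool, w.length = n - 2 ∧ p = maskElt (true :: true :: w) := by
  obtain ⟨m, rfl⟩ : ∃ m, n = m + 2 := ⟨n - 2, by omega⟩
  have h1 : 2 ^ (m + 2) = 4 * 2 ^ m := by ring
  have h2 : 2 ^ (m + 2 - 1) = 2 * 2 ^ m := by
    rw [show m + 2 - 1 = m + 1 by omega]; ring
  rw [Nat.add_sub_cancel, Set.mem_Ioc, h1, h2]
  constructor
  · rintro ⟨hl, hu⟩
    obtain ⟨w, hw, hx⟩ := exists_maskCompl_eq (n := m) (x := 4 * 2 ^ m - p) (by omega)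
    refine ⟨w, hw, ?_⟩
    simp only [maskElt, maskCompl, List.length_cons, hw, hx]
    rw [show m + 1 + 1 = m + 2 by rfl, h1]
    omega
  · rintro ⟨w, hw, rfl⟩
    have := maskCompl_lt w
    rw [hw] at this
    simp only [maskElt, maskCompl, List.length_cons, hw]
    rw [show m + 1 + 1 = m + 2 by rfl, h1]
    omega

/-! ### Block words and binary partitions -/

theorem exists_ofFn_eq (T : List (ℕ × ℕ)) :
    ∃ (r : ℕ) (a b : Fin r → ℕ), T = List.ofFn fun i => (a i, b i) :=
  ⟨T.length, fun i => (T.get i).1, fun i => (T.get i).2, (List.ofFn_get T).symm⟩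

theorem pairwise_ofFn_iff {r : ℕ} {a b : Fin r → ℕ} :
    (List.ofFn fun i => (a i, b i)).Pairwise (fun t t' => t.1 < t'.1) ↔ StrictMono a :=
  List.pairwise_ofFn

theorem maximalWord_eq {r : ℕ} (a b : Fin r → ℕ) :
    maximalWord a b =
      (true :: blockWord (List.ofFn fun i => (a i, b i))).map Bool.toNat := by
  unfold maximalWord blockWord
  rw [List.map_cons, List.map_flatMap, List.flatMap_def, List.map_ofFn]
  congr 2
  simp [Function.comp_def]

theorem length_blockWord_ofFn {r : ℕ} (a b : Fin r → ℕ) :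
    (blockWord (List.ofFn fun i => (a i, b i))).length = ∑ i, (b i + 1) * 2 ^ a i := by
  rw [length_blockWord, List.map_ofFn, List.sum_ofFn]
  rfl

theorem count_blockWord_ofFn {r : ℕ} (a b : Fin r → ℕ) :
    (blockWord (List.ofFn fun i => (a i, b i))).count true = ∑ i, 2 ^ a i := by
  rw [count_blockWord, List.map_ofFn, List.sum_ofFn]
  rfl

theorem laverPeriod_blockWord {T : List (ℕ × ℕ)} (hT : T.Pairwise fun t t' => t.1 < t'.1) :
    laverPeriod (maskElt (true :: blockWord T)) = 2 ^ (1 + (blockWord T).count true) := by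
  rw [laverPeriod_maskElt, show maskOrd _ = _ from maskMax_blockWord hT, List.count_cons_self,
    add_comm]

theorem maskElt_blockWord_mem {n : ℕ} (hn : 2 ≤ n) {T : List (ℕ × ℕ)}
    (hlen : (blockWord T).length = n - 1) :
    maskElt (true :: blockWord T) ∈ Set.Ioc (2 ^ (n - 1) + 2 ^ (n - 2)) (2 ^ n) := by
  rw [mem_Ioc_iff_exists_mask hn]
  cases T with
  | nil => simp [blockWord_nil] at hlen; omega
  | cons t T =>
    obtain ⟨k, hk⟩ : ∃ k, 2 ^ t.1 = k + 1 := ⟨2 ^ t.1 - 1, by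
      have : 0 < 2 ^ t.1 := by positivity
      omega⟩
    rw [blockWord_cons, hk, List.replicate_succ, List.cons_append, List.cons_append] at hlen ⊢
    exact ⟨_, by simp only [List.length_cons] at hlen; omega, rfl⟩

theorem exists_blockWord_of_isLaverMaximal {n p : ℕ} (hn : 2 ≤ n)
    (hp : p ∈ Set.Ioc (2 ^ (n - 1) + 2 ^ (n - 2)) (2 ^ n)) (hmax : IsLaverMaximal p) :
    ∃ T : List (ℕ × ℕ), T.Pairwise (fun t t' => t.1 < t'.1) ∧ (blockWord T).length = n - 1 ∧
      p = maskElt (true :: blockWord T) := by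
  obtain ⟨w, hw, rfl⟩ := (mem_Ioc_iff_exists_mask hn).mp hp
  obtain ⟨T, hT, hTw⟩ := exists_blockWord_of_maskMax_cons_cons
    ((isLaverMaximal_maskElt_iff _).mp hmax)
  exact ⟨T, hT, by rw [← hTw, List.length_cons, hw]; omega, by rw [hTw]⟩

theorem blockWord_head (T : List (ℕ × ℕ)) (v : List Bool) : false :: v ≠ blockWord T := by
  cases T with
  | nil => simp [blockWord_nil]
  | cons t T =>
    obtain ⟨k, hk⟩ : ∃ k, 2 ^ t.1 = k + 1 := ⟨2 ^ t.1 - 1, by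
      have : 0 < 2 ^ t.1 := by positivity
      omega⟩
    rw [blockWord_cons, hk, List.replicate_succ]
    simp

theorem replicate_append_blockWord_inj {k k' : ℕ} {T T' : List (ℕ × ℕ)}
    (h : List.replicate k false ++ blockWord T = List.replicate k' false ++ blockWord T') :
    k = k' ∧ blockWord T = blockWord T' := by
  induction k generalizing k' with
  | zero =>
    cases k' with
    | zero => simpa using h
    | succ k' => exact absurd (by simpa [List.replicate_succ] using h.symm) (blockWord_head _ _)
  | succ k ih =>
    cases k' with
    | zero => exact absurd (by simpa [List.replicate_succ] using h) (blockWord_head _ _)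
    | succ k' =>
      have := ih (k' := k') (by simpa [List.replicate_succ] using h)
      exact ⟨by omega, this.2⟩

/-- The sizes of the blocks are read off the number of ones in the word, whose binary expansion
they are; then the gaps are determined one after the other. -/
theorem blockWord_inj {T T' : List (ℕ × ℕ)} (hT : T.Pairwise fun t t' => t.1 < t'.1)
    (hT' : T'.Pairwise fun t t' => t.1 < t'.1) (h : blockWord T = blockWord T') : T = T' := by
  have hbits : ∀ T : List (ℕ × ℕ), T.Pairwise (fun t t' => t.1 < t'.1) →
      ((blockWord T).count true).bitIndices = T.map Prod.fst := by
    intro T hT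
    have := Nat.bitIndices_sum_map_two_pow (L := T.map Prod.fst)
      (List.Pairwise.sortedLT (List.pairwise_map.mpr hT))
    rw [List.map_map] at this
    rw [count_blockWord]
    exact this
  have hfst : T.map Prod.fst = T'.map Prod.fst := by rw [← hbits T hT, ← hbits T' hT', h]
  clear hT hT' hbits
  induction T generalizing T' with
  | nil => simpa using hfst
  | cons t T ih =>
    cases T' with
    | nil => simp at hfst
    | cons t' T' =>
      obtain ⟨s, b⟩ := t
      obtain ⟨s', b'⟩ := t'
      simp only [List.map_cons, List.cons.injEq] at hfst
      obtain ⟨rfl, hfst⟩ := hfst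
      rw [blockWord_cons, blockWord_cons, List.append_assoc, List.append_assoc] at h
      obtain ⟨h1, h2⟩ := replicate_append_blockWord_inj (List.append_cancel_left h)
      have hb : b = b' := Nat.eq_of_mul_eq_mul_right (by positivity) h1
      rw [ih h2 hfst, hb]

/-- The partition with `b + 1` parts `2 ^ a` for each pair `(a, b)` of the list. -/
def blockParts (T : List (ℕ × ℕ)) : Multiset ℕ :=
  (T.map fun t => Multiset.replicate (t.2 + 1) (2 ^ t.1)).sum

theorem blockParts_cons (t : ℕ × ℕ) (T : List (ℕ × ℕ)) :
    blockParts (t :: T) = Multiset.replicate (t.2 + 1) (2 ^ t.1) + blockParts T := by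
  simp [blockParts]

theorem mem_blockParts {T : List (ℕ × ℕ)} {x : ℕ} :
    x ∈ blockParts T ↔ ∃ t ∈ T, x = 2 ^ t.1 := by
  induction T with
  | nil => simp [blockParts]
  | cons t T ih => 
    rw [blockParts_cons, Multiset.mem_add, Multiset.mem_replicate, ih]
    simp only [List.mem_cons, exists_eq_or_imp]
    exact or_congr_left (and_iff_right (Nat.succ_ne_zero _))

theorem sum_blockParts (T : List (ℕ × ℕ)) : (blockParts T).sum = (blockWord T).length := by
  rw [length_blockWord]
  induction T with
  | nil => simp [blockParts]
  | cons t T ih => simp [blockParts_cons, ih]; ring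

theorem count_blockParts {T : List (ℕ × ℕ)} (hT : T.Pairwise fun t t' => t.1 < t'.1)
    {s b : ℕ} (h : (s, b) ∈ T) : (blockParts T).count (2 ^ s) = b + 1 := by
  induction T with
  | nil => simp at h
  | cons t T ih =>
    obtain ⟨h1, h2⟩ := List.pairwise_cons.mp hT
    rw [blockParts_cons, Multiset.count_add, Multiset.count_replicate]
    rcases List.mem_cons.mp h with rfl | h
    · rw [if_pos rfl, Multiset.count_eq_zero_of_notMem, add_zero]
      rw [mem_blockParts]
      rintro ⟨t, ht, hts⟩
      have := Nat.pow_right_injective le_rfl hts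
      exact absurd (h1 t ht) (by simp [← this])
    · have := h1 _ h
      rw [ih h2 h, if_neg, zero_add]
      intro he
      have := Nat.pow_right_injective le_rfl he
      simp at *
      omega

theorem blockParts_inj {T T' : List (ℕ × ℕ)} (hT : T.Pairwise fun t t' => t.1 < t'.1)
    (hT' : T'.Pairwise fun t t' => t.1 < t'.1) (h : blockParts T = blockParts T') : T = T' := by
  have sub : ∀ {T T' : List (ℕ × ℕ)}, T.Pairwise (fun t t' => t.1 < t'.1) →
      T'.Pairwise (fun t t' => t.1 < t'.1) → blockParts T = blockParts T' →
      ∀ t ∈ T, t ∈ T' := by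
    intro T T' hT hT' h t ht
    have h1 : 2 ^ t.1 ∈ blockParts T' := h ▸ mem_blockParts.mpr ⟨t, ht, rfl⟩
    obtain ⟨t', ht', hs⟩ := mem_blockParts.mp h1
    have hs := Nat.pow_right_injective le_rfl hs
    have h2 := count_blockParts hT (s := t.1) (b := t.2) ht
    have h3 := count_blockParts hT' (s := t'.1) (b := t'.2) ht'
    rw [h, hs, h3] at h2
    have : t = t' := Prod.ext hs (by omega)
    rwa [this]
  have nodup : ∀ {T : List (ℕ × ℕ)}, T.Pairwise (fun t t' => t.1 < t'.1) → T.Nodup :=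
    fun hT => hT.imp fun h he => by rw [he] at h; exact lt_irrefl _ h
  refine List.Perm.eq_of_pairwise (fun a b _ _ h h' => absurd h (lt_asymm h')) hT hT' ?_
  rw [List.perm_ext_iff_of_nodup (nodup hT) (nodup hT')]
  exact fun t => ⟨sub hT hT' h t, sub hT' hT h.symm t⟩

theorem exists_blockParts_eq {P : Multiset ℕ} (hP : ∀ i ∈ P, ∃ a : ℕ, i = 2 ^ a) :
    ∃ T : List (ℕ × ℕ), T.Pairwise (fun t t' => t.1 < t'.1) ∧ blockParts T = P := by
  classical
  set E := P.toFinset.image (Nat.log 2) with hE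
  have hmem : ∀ s, s ∈ E ↔ 2 ^ s ∈ P := by
    intro s
    simp only [hE, Finset.mem_image, Multiset.mem_toFinset]
    constructor
    · rintro ⟨i, hi, rfl⟩
      obtain ⟨a, rfl⟩ := hP i hi
      rwa [Nat.log_pow (by norm_num)]
    · exact fun h => ⟨_, h, Nat.log_pow (by norm_num) s⟩
  set T := (E.sort (· ≤ ·)).map fun s => (s, P.count (2 ^ s) - 1) with hTdef
  have hT : T.Pairwise fun t t' => t.1 < t'.1 := by
    rw [hTdef, List.pairwise_map]
    exact (Finset.sortedLT_sort E).pairwise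
  have hmemT : ∀ s, 2 ^ s ∈ P → (s, P.count (2 ^ s) - 1) ∈ T := fun s hs =>
    List.mem_map.mpr ⟨s, (Finset.mem_sort _).mpr ((hmem s).mpr hs), rfl⟩
  refine ⟨T, hT, Multiset.ext.mpr fun x => ?_⟩
  by_cases hx : x ∈ P
  · obtain ⟨s, rfl⟩ := hP x hx
    have := Multiset.count_pos.mpr hx
    rw [count_blockParts hT (hmemT s hx)]
    omega
  · rw [Multiset.count_eq_zero_of_notMem hx, Multiset.count_eq_zero_of_notMem]
    rw [mem_blockParts]
    rintro ⟨t, ht, rfl⟩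
    obtain ⟨s, hs, rfl⟩ := List.mem_map.mp ht
    exact hx ((hmem s).mp ((Finset.mem_sort _).mp hs))

/-- Lists of pairs `(a, b)` with `a` increasing and total length `n` of the corresponding
word. -/
def BlockList (n : ℕ) : Type :=
  {T : List (ℕ × ℕ) // T.Pairwise (fun t t' => t.1 < t'.1) ∧ (blockWord T).length = n}

/-- The binary partition of a list of blocks. -/
def BlockList.toPartition {n : ℕ} (T : BlockList n) : BinaryPartition n :=
  ⟨{ parts := blockParts T.1
     parts_pos := fun h => by
      obtain ⟨t, -, rfl⟩ := mem_blockParts.mp h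
      positivity
     parts_sum := by rw [sum_blockParts, T.2.2] },
    fun i hi => by
      obtain ⟨t, -, rfl⟩ := mem_blockParts.mp hi
      exact ⟨_, rfl⟩⟩

theorem BlockList.toPartition_bijective (n : ℕ) :
    Function.Bijective (BlockList.toPartition (n := n)) := by
  constructor
  · intro T T' h
    exact Subtype.ext (blockParts_inj T.2.1 T'.2.1 (congrArg (fun P => P.1.parts) h))
  · intro P
    obtain ⟨T, hT, hTP⟩ := exists_blockParts_eq P.2
    refine ⟨⟨T, hT, ?_⟩, Subtype.ext (Nat.Partition.ext hTP)⟩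
    rw [← sum_blockParts, hTP, P.1.parts_sum]

/-- The maximal element of a list of blocks. -/
def BlockList.toMaximal {n : ℕ} (hn : 2 ≤ n) (T : BlockList (n - 1)) :
    {p : ℕ // p ∈ Set.Ioc (2 ^ (n - 1) + 2 ^ (n - 2)) (2 ^ n) ∧ IsLaverMaximal p} :=
  ⟨maskElt (true :: blockWord T.1), maskElt_blockWord_mem hn T.2.2,
    (isLaverMaximal_maskElt_iff _).mpr (maskMax_blockWord T.2.1)⟩

theorem BlockList.toMaximal_bijective {n : ℕ} (hn : 2 ≤ n) :
    Function.Bijective (BlockList.toMaximal hn) := by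
  constructor
  · intro T T' h
    have h1 : maskElt (true :: blockWord T.1) = maskElt (true :: blockWord T'.1) :=
      congrArg Subtype.val h
    have h2 := digits_maskElt (blockWord T.1)
    rw [h1, digits_maskElt, List.reverse_inj] at h2
    have h3 := map_toNat_injective h2
    exact Subtype.ext (blockWord_inj T.2.1 T'.2.1 (List.cons.inj h3).2.symm)
  · rintro ⟨p, hp, hmax⟩
    obtain ⟨T, hT, hlen, rfl⟩ := exists_blockWord_of_isLaverMaximal hn hp hmax
    exact ⟨⟨T, hT, hlen⟩, rfl⟩

theorem mainTheorem1 (n : ℕ) (hn : 2 ≤ n) :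
    (∀ (r : ℕ) (a b : Fin r → ℕ), StrictMono a →
      n - 1 = ∑ i, (b i + 1) * 2 ^ a i →
      ∃ p ∈ Set.Ioc (2 ^ (n - 1) + 2 ^ (n - 2)) (2 ^ n),
        Nat.digits 2 (p - 1) = (maximalWord a b).reverse ∧
        IsLaverMaximal p ∧ laverPeriod p = 2 ^ (1 + ∑ i, 2 ^ a i)) ∧
    (∀ p ∈ Set.Ioc (2 ^ (n - 1) + 2 ^ (n - 2)) (2 ^ n), IsLaverMaximal p →
      ∃ (r : ℕ) (a b : Fin r → ℕ), StrictMono a ∧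
        n - 1 = ∑ i, (b i + 1) * 2 ^ a i ∧
        Nat.digits 2 (p - 1) = (maximalWord a b).reverse) ∧
    ∃ Φ : BinaryPartition (n - 1) ≃
        {p : ℕ // p ∈ Set.Ioc (2 ^ (n - 1) + 2 ^ (n - 2)) (2 ^ n) ∧ IsLaverMaximal p},
      ∀ P : BinaryPartition (n - 1), ∃ (r : ℕ) (a b : Fin r → ℕ), StrictMono a ∧
        P.1.parts = ∑ i, Multiset.replicate (b i + 1) (2 ^ a i) ∧
        Nat.digits 2 ((Φ P : ℕ) - 1) = (maximalWord a b).reverse ∧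
        laverPeriod (Φ P : ℕ) = 2 ^ (1 + ∑ i, 2 ^ a i) := by
  refine ⟨fun r a b ha hsum => ?_, fun p hp hmax => ?_, ?_⟩
  · have hT := pairwise_ofFn_iff (b := b).mpr ha
    refine ⟨maskElt (true :: blockWord (List.ofFn fun i => (a i, b i))),
      maskElt_blockWord_mem hn (by rw [length_blockWord_ofFn, hsum]), ?_,
      (isLaverMaximal_maskElt_iff _).mpr (maskMax_blockWord hT), ?_⟩
    · rw [digits_maskElt, maximalWord_eq]
    · rw [laverPeriod_blockWord hT, count_blockWord_ofFn]
  · obtain ⟨T, hT, hlen, rfl⟩ := exists_blockWord_of_isLaverMaximal hn hp hmax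
    obtain ⟨r, a, b, rfl⟩ := exists_ofFn_eq T
    exact ⟨r, a, b, pairwise_ofFn_iff.mp hT, by rw [← hlen, length_blockWord_ofFn],
      by rw [digits_maskElt, maximalWord_eq]⟩
  · let e₁ := Equiv.ofBijective _ (BlockList.toPartition_bijective (n - 1))
    let e₂ := Equiv.ofBijective _ (BlockList.toMaximal_bijective hn)
    refine ⟨e₁.symm.trans e₂, fun P => ?_⟩
    obtain ⟨T, rfl⟩ := e₁.surjective P
    have hΦ : ((e₁.symm.trans e₂) (e₁ T) : ℕ) = maskElt (true :: blockWord T.1) := by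
      rw [Equiv.trans_apply, Equiv.symm_apply_apply]
      rfl
    have hparts : (e₁ T).1.parts = blockParts T.1 := rfl
    obtain ⟨T, hT, hlen⟩ := T
    obtain ⟨r, a, b, rfl⟩ := exists_ofFn_eq T
    refine ⟨r, a, b, pairwise_ofFn_iff.mp hT, ?_, ?_, ?_⟩
    · rw [hparts, blockParts, List.map_ofFn, List.sum_ofFn]
      rfl
    · rw [hΦ, digits_maskElt, maximalWord_eq]
    · rw [hΦ, laverPeriod_blockWord hT, count_blockWord_ofFn]
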